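/- A \emph{symmetric sequence space} is a linear space $E$ of real null sequences with a complete norm $\|\cdot\|_E$ such that: (i) if $y\in E$ and $|x|\le|y|$ coordinatewise, then $x\in E$ and $\|x\|_E\le\|y\|_E$; (ii) a null sequence $x$ belongs to $E$ if and only if its non-increasing rearrangement $x^*$ (of $|x|$) does, and then $\|x^*\|_E=\|x\|_E$; (iii) $(1,0,0,\dots)\in E$ has norm $1$. For $1\le p,q\le\infty$, $E$ is \emph{$p$-convex with constant $K$} if $\|(\sum_{k=1}^m|x_k|^p)^{1/p}\|_E\le K(\sum_{k=1}^m\|x_k\|_E^p)^{1/p}$, and \emph{$q$-concave with constant $L$} if $(\sum_{k=1}^m\|x_k\|_E^q)^{1/q}\le L\|(\sum_{k=1}^m|x_k|^q)^{1/q}\|_E$, for all finite families $x_1,\dots,x_m\in E$ (with the usual maximum when the exponent is $\infty$). For symmetric sequence spaces $E,F$ let $B(E,F)$ be the space of real infinite matrices $A=(a_{ij})_{i,j\ge1}$ defining bounded operators $x\mapsto(\sum_j a_{ij}x_j)_i$ from $E$ to $F$ (the series converging absolutely for all $x\in E$), with operator norm $\|A\|_{E,F}$. An infinite matrix $M$ is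 an \emph{$(E,F)$-multiplier} if the entrywise product $M*A$ is in $B(E,F)$ for every $A\in B(E,F)$, and then $\|M\|_{(E,F)}=\sup\{\|M*A\|_{E,F}:\|A\|_{E,F}\le1\}$. Let $T_n$ be the $n$-th main triangle projection, i.e. the matrix with $(i,j)$ entry $1$ if $1\le j\le i\le n$ and $0$ otherwise, acting by entrywise multiplication. \textbf{Proposition.} Let $1\le q\le p\le\infty$ with $p\ne1$ and $q\ne\infty$. There is a constant $C(p,q)>0$, depending only on $p$ and $q$, such that for all symmetric sequence spaces $E$ and $F$, if $E$ is $p$-convex with constant $K$ and $F$ is $q$-concave with constant $L$, then for every $n\ge1$ the matrix $T_n$ is an $(E,F)$-multiplier and $$\|T_n\|_{(E,F)}\ \ge\ \frac{C(p,q)}{K\,L}\,\ln n .$$ In particular $\|T_n\|_{(E,F)}\ge C(p,q)\ln n$ when the convexity constant of $E$ and the concavity constant of $F$ are normalized to be $1$. -/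

import Mathlib

open Filter Topology
open scoped ENNReal Matrix

noncomputable section

/-- The non-increasing rearrangement `x*` of `|x|` for a real null sequence `x` (indices start
at `0`): `x* i` is the least `s ≥ 0` such that at most `i` terms satisfy `s < |x j|`. -/
def rearrangement (x : ℕ → ℝ) : ℕ → ℝ :=
  fun i => sInf {s : ℝ | 0 ≤ s ∧ {j : ℕ | s < |x j|}.encard ≤ (i : ℕ∞)}

/-- A symmetric sequence space: a solid, rearrangement-invariant linear space of real null
sequences, complete under a solid rearrangement-invariant norm, with `‖(1, 0, 0, …)‖ = 1`. -/
structure SymmetricSequenceSpace where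
  /-- the underlying linear space of sequences -/
  carrier : Submodule ℝ (ℕ → ℝ)
  /-- the norm -/
  nrm : Seminorm ℝ carrier
  eq_zero_of_nrm : ∀ x : carrier, nrm x = 0 → x = 0
  complete : ∀ u : ℕ → carrier,
    (∀ ε : ℝ, 0 < ε → ∃ N : ℕ, ∀ m ≥ N, ∀ n ≥ N, nrm (u m - u n) < ε) →
      ∃ x : carrier, Tendsto (fun n => nrm (u n - x)) atTop (𝓝 0)
  tendsto_zero : ∀ x : carrier, Tendsto (x : ℕ → ℝ) atTop (𝓝 0)
  solid : ∀ (x : ℕ → ℝ) (y : carrier), (∀ i, |x i| ≤ |(y : ℕ → ℝ) i|) → x ∈ carrier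
  nrm_mono : ∀ x y : carrier, (∀ i, |(x : ℕ → ℝ) i| ≤ |(y : ℕ → ℝ) i|) → nrm x ≤ nrm y
  rearrangement_mem_iff : ∀ x : ℕ → ℝ, Tendsto x atTop (𝓝 0) →
    (rearrangement x ∈ carrier ↔ x ∈ carrier)
  nrm_rearrangement : ∀ (x : ℕ → ℝ) (hx : x ∈ carrier) (hx' : rearrangement x ∈ carrier),
    nrm ⟨rearrangement x, hx'⟩ = nrm ⟨x, hx⟩
  unit_mem : (Pi.single 0 1 : ℕ → ℝ) ∈ carrier
  nrm_unit : nrm ⟨Pi.single 0 1, unit_mem⟩ = 1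

/-- `(∑ k, |a k| ^ p) ^ (1 / p)` for a finite family of reals, and `max |a k|` if `p = ∞`. -/
def finLpNorm (p : ℝ≥0∞) {m : ℕ} (a : Fin m → ℝ) : ℝ :=
  ‖(WithLp.toLp p a : PiLp p (fun _ : Fin m => ℝ))‖

theorem abs_finLpNorm_le_sum (p : ℝ≥0∞) [Fact (1 ≤ p)] {m : ℕ} (a : Fin m → ℝ) :
    |finLpNorm p a| ≤ ∑ k, |a k| := by
  unfold finLpNorm
  rw [abs_of_nonneg (norm_nonneg _)]
  have h : (WithLp.toLp p a : PiLp p (fun _ : Fin m => ℝ))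
      = ∑ k, PiLp.single p k (a k) := by
    ext i
    simp [Pi.single_apply]
  rw [h]
  refine (norm_sum_le _ _).trans (le_of_eq ?_)
  simp

namespace SymmetricSequenceSpace

/-- The sequence `(∑ k, |x k| ^ p) ^ (1 / p)`, formed coordinatewise, lies in the space. -/
theorem finLpNorm_mem (E : SymmetricSequenceSpace) (p : ℝ≥0∞) [Fact (1 ≤ p)] {m : ℕ}
    (x : Fin m → E.carrier) :
    (fun i => finLpNorm p (fun k => (x k : ℕ → ℝ) i)) ∈ E.carrier := by
  have habs : ∀ k, (fun i => |(x k : ℕ → ℝ) i|) ∈ E.carrier :=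
    fun k => E.solid _ (x k) (fun i => by simp)
  have hsum := E.carrier.sum_mem (t := Finset.univ) (fun k _ => habs k)
  refine E.solid _ ⟨_, hsum⟩ (fun i => ?_)
  refine (abs_finLpNorm_le_sum p _).trans ((le_abs_self _).trans (le_of_eq ?_))
  simp

/-- `(∑ k, |x k| ^ p) ^ (1 / p)`, formed coordinatewise, as an element of the space. -/
def lpSum (E : SymmetricSequenceSpace) (p : ℝ≥0∞) [Fact (1 ≤ p)] {m : ℕ}
    (x : Fin m → E.carrier) : E.carrier :=
  ⟨fun i => finLpNorm p (fun k => (x k : ℕ → ℝ) i), E.finLpNorm_mem p x⟩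

/-- `E` is `p`-convex with constant `K`. -/
def IsConvexWith (E : SymmetricSequenceSpace) (p : ℝ≥0∞) [Fact (1 ≤ p)] (K : ℝ) : Prop :=
  ∀ (m : ℕ) (x : Fin m → E.carrier),
    E.nrm (E.lpSum p x) ≤ K * finLpNorm p (fun k => E.nrm (x k))

/-- `E` is `q`-concave with constant `L`. -/
def IsConcaveWith (E : SymmetricSequenceSpace) (q : ℝ≥0∞) [Fact (1 ≤ q)] (L : ℝ) : Prop :=
  ∀ (m : ℕ) (x : Fin m → E.carrier),
    finLpNorm q (fun k => E.nrm (x k)) ≤ L * E.nrm (E.lpSum q x)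

end SymmetricSequenceSpace

/-- The action of an infinite matrix on a sequence: `(A x) i = ∑ j, A i j * x j`. -/
def matrixApply (A : Matrix ℕ ℕ ℝ) (x : ℕ → ℝ) : ℕ → ℝ :=
  fun i => ∑' j, A i j * x j

/-- `A ∈ B(E, F)`: the matrix `A` defines a bounded linear operator from `E` to `F`. -/
structure IsBoundedMatrix (E F : SymmetricSequenceSpace) (A : Matrix ℕ ℕ ℝ) : Prop where
  summable : ∀ (x : E.carrier) (i : ℕ), Summable (fun j => A i j * (x : ℕ → ℝ) j)
  mem : ∀ x : E.carrier, matrixApply A x ∈ F.carrier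
  bound : ∃ c : ℝ, ∀ x : E.carrier, F.nrm ⟨matrixApply A x, mem x⟩ ≤ c * E.nrm x

/-- The operator norm `‖A‖_{E,F} = sup {‖A x‖_F : ‖x‖_E ≤ 1}` of `A ∈ B(E, F)`. -/
def matrixOpNorm {E F : SymmetricSequenceSpace} {A : Matrix ℕ ℕ ℝ}
    (hA : IsBoundedMatrix E F A) : ℝ :=
  ⨆ x : {x : E.carrier // E.nrm x ≤ 1}, F.nrm ⟨matrixApply A x.1, hA.mem x.1⟩

/-- `M` is an `(E, F)`-multiplier: the Schur product `M * A` is in `B(E, F)` whenever `A` is. -/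
def IsMultiplier (E F : SymmetricSequenceSpace) (M : Matrix ℕ ℕ ℝ) : Prop :=
  ∀ A : Matrix ℕ ℕ ℝ, IsBoundedMatrix E F A → IsBoundedMatrix E F (M ⊙ A)

/-- The multiplier norm `‖M‖_{(E,F)} = sup {‖M * A‖_{E,F} : ‖A‖_{E,F} ≤ 1}`. -/
def multiplierNorm {E F : SymmetricSequenceSpace} {M : Matrix ℕ ℕ ℝ}
    (hM : IsMultiplier E F M) : ℝ :=
  ⨆ A : {A : Matrix ℕ ℕ ℝ // ∃ hA : IsBoundedMatrix E F A, matrixOpNorm hA ≤ 1},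
    matrixOpNorm (hM A.1 A.2.choose)

/-- The `n`-th main triangle projection as a Schur multiplier: with indices starting at `0`,
`triangleProjection n ⊙ A` keeps the entries `A i j` with `j ≤ i < n` and kills the others. -/
def triangleProjection (n : ℕ) : Matrix ℕ ℕ ℝ :=
  Matrix.of fun i j => if j ≤ i ∧ i < n then 1 else 0

end

/-! The test matrix is a smoothed Hilbert matrix `hilbertMatrix n`. Its kernel `t / (t ^ 2 + 1)` is
odd, and cancellation keeps the matrix bounded on `ℓ ^ r` uniformly in `n`, for each `1 < r < ∞`. On
and below the diagonal the entries are positive, of size at least a multiple of `1 / (i - j + 1)`,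
so truncation to the triangle destroys the cancellation and the row sums grow like `log n`.

The `ℓ ^ r` bound is M. Riesz's theorem, proved by contour integration. For `x ≥ 0` the Cauchy
transform `G` maps the upper half-plane into the right half-plane, so `G ^ r` is holomorphic and its
integral along `Im z = 1` vanishes in the limit. Since `‖G‖ ^ r ≤ A (re G) ^ r - B re (G ^ r)` for
`1 < r ≤ 2`, the positive Poisson part `re G` controls everything. Exponents `r ≥ 2` follow by
duality (`exists_sum_hilbertMatrix_rpow_le`).

To pass to `E` and `F`, convexity and concavity are applied to the `n` cyclic shifts of one vector.
Relative to the norm of the all-ones vector, `E` then dominates `ℓ ^ p` up to `K`, and `ℓ ^ q`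
dominates `F` up to `L` (`IsConvexWith.finLpNorm_mul_le`, `IsConcaveWith.nrm_mul_le`). An exponent
`r` between `q` and `p` with `1 < r < ∞` bounds the matrix from `E` to `F` by `C * K * L * ‖1‖_F /
‖1‖_E`. Its truncation, tested on the all-ones vector, exceeds this by a factor of order `log n / (K
* L)`. -/

noncomputable section

/-! ### Pointwise inequality behind the Riesz theorem -/

/-- On the right half-plane the modulus power `‖z‖ ^ r`, `1 < r ≤ 2`, is controlled by
`(re z) ^ r` and the harmonic function `re (z ^ r)`. -/
theorem exists_norm_rpow_le_re_rpow_sub_re_cpow {r : ℝ} (hr : 1 < r) (hr2 : r ≤ 2) :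
    ∃ A B : ℝ, 0 ≤ A ∧ 0 ≤ B ∧ ∀ z : ℂ, 0 < z.re →
      ‖z‖ ^ r ≤ A * z.re ^ r - B * (z ^ (r : ℂ)).re := by
  have hπ := Real.pi_pos
  have hr0 : 0 < r := by linarith
  -- The midpoint of `π / (2 * r)` and `π / 2`: the sector `|arg z| < φ` stays off the imaginary
  -- axis, while outside it `cos (r * arg z)` is already negative.
  set φ := (Real.pi / r + Real.pi) / 4 with hφ
  have hdiv : Real.pi / r < Real.pi := div_lt_self hπ hr
  have hdiv0 : 0 < Real.pi / r := by positivity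
  have hφ0 : 0 < φ := by positivity
  have hφ1 : φ < Real.pi / 2 := by linarith
  have hφr : φ * r = (Real.pi + Real.pi * r) / 4 := by rw [hφ]; field_simp
  have hφr1 : Real.pi / 2 < φ * r := by rw [hφr]; nlinarith
  have hφr2 : φ * r ≤ Real.pi := by rw [hφr]; nlinarith
  have hcneg : Real.cos (φ * r) < 0 :=
    Real.cos_neg_of_pi_div_two_lt_of_lt hφr1 (by linarith)
  have hcpos : 0 < Real.cos φ := Real.cos_pos_of_mem_Ioo ⟨by linarith, hφ1⟩
  set b := -Real.cos (φ * r) with hb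
  have hbpos : 0 < b := by rw [hb]; linarith
  have hcr : 0 < Real.cos φ ^ r := Real.rpow_pos_of_pos hcpos r
  refine ⟨(1 + 1 / b) / Real.cos φ ^ r, 1 / b, by positivity, by positivity, fun z hz => ?_⟩
  have hz0 : 0 < ‖z‖ := norm_pos_iff.2 (fun h => by simp [h] at hz)
  have hnr : 0 < ‖z‖ ^ r := Real.rpow_pos_of_pos hz0 r
  have habs : |z.arg| ≤ Real.pi / 2 := Complex.abs_arg_le_pi_div_two_iff.2 hz.le
  have hcosarg : Real.cos (z.arg * r) = Real.cos (|z.arg| * r) := by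
    rw [← Real.cos_abs (z.arg * r), abs_mul, abs_of_pos hr0]
  have hre : z.re = ‖z‖ * Real.cos |z.arg| := by
    rw [Real.cos_abs, Complex.norm_mul_cos_arg]
  rw [Complex.cpow_ofReal_re, hcosarg]
  set θ := |z.arg| with hθ
  have hθ0 : 0 ≤ θ := abs_nonneg _
  rcases le_or_gt φ θ with h | h
  -- Near the imaginary axis the term `-B * re (z ^ r)` alone suffices; `r ≤ 2` keeps `θ * r ≤ π`,
  -- where cosine is still decreasing.
  · have h1 : Real.cos (θ * r) ≤ Real.cos (φ * r) :=
      Real.cos_le_cos_of_nonneg_of_le_pi (by positivity) (by nlinarith)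
        (mul_le_mul_of_nonneg_right h hr0.le)
    have h2 : 1 ≤ 1 / b * -Real.cos (θ * r) := by
      rw [one_div, inv_mul_eq_div, le_div_iff₀ hbpos]; linarith
    have h3 : 0 ≤ (1 + 1 / b) / Real.cos φ ^ r * z.re ^ r := by positivity
    nlinarith
  -- Inside the sector `re z` is comparable to `‖z‖`, so the first term also absorbs the possibly
  -- positive `re (z ^ r)`.
  · have h1 : Real.cos φ ≤ Real.cos θ :=
      Real.cos_le_cos_of_nonneg_of_le_pi hθ0 (by linarith) h.le
    have h2 : Real.cos φ ^ r ≤ Real.cos θ ^ r := Real.rpow_le_rpow hcpos.le h1 hr0.le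
    have h3 : 1 + 1 / b ≤ (1 + 1 / b) / Real.cos φ ^ r * Real.cos θ ^ r := by
      rw [div_mul_eq_mul_div, le_div_iff₀ hcr]
      gcongr
    have h4 : z.re ^ r = ‖z‖ ^ r * Real.cos θ ^ r := by
      rw [hre, Real.mul_rpow hz0.le (hcpos.le.trans h1)]
    have h5 : 1 / b * Real.cos (θ * r) ≤ 1 / b :=
      mul_le_of_le_one_right (by positivity) (Real.cos_le_one _)
    rw [h4]
    nlinarith

/-! ### Cauchy transform and its contour integral -/

/-- The Cauchy transform `z ↦ ∑ j, x j * I / (z - j)` of the point masses `x j` at `j < n`. -/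
def cauchyTransform {n : ℕ} (x : Fin n → ℝ) (z : ℂ) : ℂ :=
  ∑ j, (x j : ℂ) * (Complex.I / (z - (j : ℕ)))

theorem sub_natCast_ne_zero_of_im_pos {z : ℂ} (hz : 0 < z.im) (j : ℕ) : z - j ≠ 0 := by
  intro h
  have := congrArg Complex.im h
  simp at this
  linarith

/-- The real part is `im z / ‖z - j‖ ^ 2`. This is why the transform carries the factor `I`. -/
theorem re_I_div_sub_natCast_pos {z : ℂ} (hz : 0 < z.im) (j : ℕ) :
    0 < (Complex.I / (z - j)).re := by
  have h := Complex.normSq_pos.2 (sub_natCast_ne_zero_of_im_pos hz j)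
  rw [Complex.div_re]
  simp
  positivity

theorem cauchyTransform_re_pos {n : ℕ} {x : Fin n → ℝ} (hx : ∀ j, 0 ≤ x j) (hx0 : x ≠ 0)
    {z : ℂ} (hz : 0 < z.im) : 0 < (cauchyTransform x z).re := by
  obtain ⟨k, hk⟩ := Function.ne_iff.1 hx0
  rw [cauchyTransform, Complex.re_sum]
  refine Finset.sum_pos' (fun j _ => ?_) ⟨k, Finset.mem_univ k, ?_⟩
  · rw [Complex.re_ofReal_mul]
    exact mul_nonneg (hx j) (re_I_div_sub_natCast_pos hz j).le
  · rw [Complex.re_ofReal_mul]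
    exact mul_pos (lt_of_le_of_ne (hx k) (Ne.symm hk)) (re_I_div_sub_natCast_pos hz k)

theorem differentiableAt_cauchyTransform {n : ℕ} (x : Fin n → ℝ) {z : ℂ} (hz : 0 < z.im) :
    DifferentiableAt ℂ (cauchyTransform x) z := by
  unfold cauchyTransform
  refine DifferentiableAt.fun_sum fun j _ => ?_
  refine (differentiableAt_const _).mul ((differentiableAt_const _).div ?_
    (sub_natCast_ne_zero_of_im_pos hz j))
  fun_prop

theorem differentiableAt_cauchyTransform_cpow {n : ℕ} {x : Fin n → ℝ} (hx : ∀ j, 0 ≤ x j)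
    (hx0 : x ≠ 0) (r : ℂ) {z : ℂ} (hz : 0 < z.im) :
    DifferentiableAt ℂ (fun z => cauchyTransform x z ^ r) z :=
  (differentiableAt_cauchyTransform x hz).cpow_const
    (Or.inl (cauchyTransform_re_pos hx hx0 hz))

theorem norm_cauchyTransform_le {n : ℕ} {x : Fin n → ℝ} (hx : ∀ j, 0 ≤ x j) {z : ℂ} {d : ℝ}
    (hd : 0 < d) (hz : ∀ j : Fin n, d ≤ ‖z - (j : ℕ)‖) :
    ‖cauchyTransform x z‖ ≤ (∑ j, x j) / d := by
  unfold cauchyTransform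
  refine (norm_sum_le _ _).trans ?_
  rw [Finset.sum_div]
  refine Finset.sum_le_sum fun j _ => ?_
  rw [norm_mul, norm_div, Complex.norm_I, Complex.norm_real, Real.norm_of_nonneg (hx j),
    mul_one_div]
  exact div_le_div_of_nonneg_left (hx j) hd (hz j)

/-- At height one the real part is a Poisson sum; the imaginary part, computed next, is the
conjugate Poisson sum that defines the matrix. -/
theorem cauchyTransform_add_I_re {n : ℕ} (x : Fin n → ℝ) (t : ℝ) :
    (cauchyTransform x (t + Complex.I)).re = ∑ j, x j * (1 / ((t - (j : ℕ)) ^ 2 + 1)) := by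
  rw [cauchyTransform, Complex.re_sum]
  refine Finset.sum_congr rfl fun j _ => ?_
  rw [Complex.re_ofReal_mul, Complex.div_re]
  simp [Complex.normSq_apply, pow_two]

theorem cauchyTransform_add_I_im {n : ℕ} (x : Fin n → ℝ) (t : ℝ) :
    (cauchyTransform x (t + Complex.I)).im =
      ∑ j, x j * ((t - (j : ℕ)) / ((t - (j : ℕ)) ^ 2 + 1)) := by
  rw [cauchyTransform, Complex.im_sum]
  refine Finset.sum_congr rfl fun j _ => ?_
  rw [Complex.im_ofReal_mul, Complex.div_im]
  simp [Complex.normSq_apply, pow_two]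

/-- Cauchy's theorem on `[-R, R] × [1, 1 + R]` replaces the bottom side by the other three, of total
length `4 * R`. They lie at distance at least `R / 2` from the masses, which sit in `[0, R / 2]`. -/
theorem norm_integral_cauchyTransform_cpow_le {n : ℕ} {x : Fin n → ℝ} (hx : ∀ j, 0 ≤ x j)
    (hx0 : x ≠ 0) {r : ℝ} (hr : 1 < r) {R : ℝ} (hR : 0 < R) (hRn : 2 * (n : ℝ) ≤ R) :
    ‖∫ t in (-R)..R, cauchyTransform x (t + Complex.I) ^ (r : ℂ)‖ ≤
      4 * R * ((∑ j, x j) / (R / 2)) ^ r := by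
  set M := ((∑ j, x j) / (R / 2)) ^ r with hM
  have key : ∀ z : ℂ, 0 < z.im → (∀ j : Fin n, R / 2 ≤ ‖z - (j : ℕ)‖) →
      ‖cauchyTransform x z ^ (r : ℂ)‖ ≤ M := by
    intro z hz h
    rw [Complex.norm_cpow_real]
    exact Real.rpow_le_rpow (norm_nonneg _) (norm_cauchyTransform_le hx (by linarith) h)
      (by linarith)
  have hj : ∀ j : Fin n, ((j : ℕ) : ℝ) ≤ R / 2 := fun j => by
    have : ((j : ℕ) : ℝ) ≤ n := by exact_mod_cast j.2.le
    linarith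
  have hj0 : ∀ j : Fin n, (0 : ℝ) ≤ ((j : ℕ) : ℝ) := fun j => by positivity
  have rect := Complex.integral_boundary_rect_eq_zero_of_differentiableOn
    (fun z => cauchyTransform x z ^ (r : ℂ)) (⟨-R, 1⟩ : ℂ) (⟨R, 1 + R⟩ : ℂ) (by
      intro z hz
      refine (differentiableAt_cauchyTransform_cpow hx hx0 r ?_).differentiableWithinAt
      have h2 := (Complex.mem_reProdIm.1 hz).2
      simp only [Set.uIcc_of_le (show (1 : ℝ) ≤ 1 + R by linarith), Set.mem_Icc] at h2
      linarith [h2.1])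
  simp only [smul_eq_mul, Complex.ofReal_one, one_mul] at rect
  have top : ‖∫ t in (-R)..R, cauchyTransform x (t + ((1 + R : ℝ) : ℂ) * Complex.I) ^ (r : ℂ)‖
      ≤ M * |R - (-R)| := by
    refine intervalIntegral.norm_integral_le_of_norm_le_const fun t _ => key _ ?_ fun j => ?_
    · simp; linarith
    · refine le_trans ?_ (Complex.abs_im_le_norm _)
      simp
      rw [abs_of_pos (by linarith)]; linarith
  have right : ‖∫ y in (1 : ℝ)..(1 + R),
      cauchyTransform x ((R : ℂ) + y * Complex.I) ^ (r : ℂ)‖ ≤ M * |1 + R - 1| := by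
    refine intervalIntegral.norm_integral_le_of_norm_le_const fun t ht => key _ ?_ fun j => ?_
    · rw [Set.uIoc_of_le (by linarith)] at ht
      simp; linarith [ht.1]
    · refine le_trans ?_ (Complex.abs_re_le_norm _)
      simp
      refine le_trans ?_ (le_abs_self _)
      linarith [hj j]
  have left : ‖∫ y in (1 : ℝ)..(1 + R),
      cauchyTransform x (((-R : ℝ) : ℂ) + y * Complex.I) ^ (r : ℂ)‖ ≤ M * |1 + R - 1| := by
    refine intervalIntegral.norm_integral_le_of_norm_le_const fun t ht => key _ ?_ fun j => ?_
    · rw [Set.uIoc_of_le (by linarith)] at ht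
      simp; linarith [ht.1]
    · refine le_trans ?_ (Complex.abs_re_le_norm _)
      simp
      refine le_trans ?_ (neg_le_abs _)
      linarith [hj0 j]
  rw [abs_of_pos (by linarith)] at top right left
  have heq : (∫ t in (-R)..R, cauchyTransform x (t + Complex.I) ^ (r : ℂ)) =
      (∫ t in (-R)..R, cauchyTransform x (t + ((1 + R : ℝ) : ℂ) * Complex.I) ^ (r : ℂ))
      - Complex.I * (∫ y in (1 : ℝ)..(1 + R), cauchyTransform x ((R : ℂ) + y * Complex.I) ^ (r : ℂ))
      + Complex.I * (∫ y in (1 : ℝ)..(1 + R),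
          cauchyTransform x (((-R : ℝ) : ℂ) + y * Complex.I) ^ (r : ℂ)) := by
    linear_combination rect
  rw [heq]
  refine (norm_add_le _ _).trans ?_
  have h1 := norm_sub_le
    (∫ t in (-R)..R, cauchyTransform x (t + ((1 + R : ℝ) : ℂ) * Complex.I) ^ (r : ℂ))
    (Complex.I * (∫ y in (1 : ℝ)..(1 + R),
      cauchyTransform x ((R : ℂ) + y * Complex.I) ^ (r : ℂ)))
  rw [norm_mul, Complex.norm_I, one_mul] at h1 ⊢
  linarith

/-! ### Poisson kernel estimates -/

theorem one_div_sq_add_one_le {a b : ℝ} (h : |a - b| ≤ 1) :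
    1 / (a ^ 2 + 1) ≤ 3 * (1 / (b ^ 2 + 1)) := by
  rw [mul_one_div, div_le_div_iff₀ (by positivity) (by positivity)]
  have h1 := (abs_le.1 h).1
  have h2 := (abs_le.1 h).2
  nlinarith [sq_nonneg (a - b), sq_nonneg (2 * a - b)]

theorem integral_one_div_sub_sq_add_one_le (c a b : ℝ) :
    ∫ t in a..b, 1 / ((t - c) ^ 2 + 1) ≤ Real.pi := by
  have h := intervalIntegral.integral_comp_sub_right (a := a) (b := b)
    (fun t : ℝ => 1 / (t ^ 2 + 1)) c
  have h2 : (fun t : ℝ => 1 / (t ^ 2 + 1)) = fun t => (1 + t ^ 2)⁻¹ := by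
    ext t; rw [one_div, add_comm]
  rw [h, h2, integral_inv_one_add_sq]
  linarith [Real.arctan_lt_pi_div_two (b - c), Real.neg_pi_div_two_lt_arctan (a - c)]

/-- Each term is at most three times the integral of the kernel over `[j, j + 1]`, and the kernel
has total mass `π`. -/
theorem sum_one_div_sub_sq_add_one_le (n : ℕ) (t : ℝ) :
    ∑ j : Fin n, 1 / ((t - (j : ℕ)) ^ 2 + 1) ≤ 3 * Real.pi := by
  have hc : Continuous fun s : ℝ => 3 * (1 / ((s - t) ^ 2 + 1)) := by
    refine continuous_const.mul (continuous_const.div (by fun_prop) fun s => by positivity)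
  rw [Fin.sum_univ_eq_sum_range (fun j : ℕ => 1 / ((t - j) ^ 2 + 1)) n]
  have h1 : ∀ j ∈ Finset.range n, 1 / ((t - (j : ℝ)) ^ 2 + 1) ≤
      ∫ s in ((j : ℕ) : ℝ)..((j + 1 : ℕ) : ℝ), 3 * (1 / ((s - t) ^ 2 + 1)) := by
    intro j _
    have hjj : (j : ℝ) ≤ ((j + 1 : ℕ) : ℝ) := by push_cast; linarith
    have h := intervalIntegral.integral_mono_on (μ := MeasureTheory.volume) hjj
      (intervalIntegrable_const (c := 1 / ((t - (j : ℝ)) ^ 2 + 1)))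
      (hc.intervalIntegrable _ _) (fun s hs => by
        have : (t - (j : ℝ)) ^ 2 = ((j : ℝ) - t) ^ 2 := by ring
        rw [this]
        refine one_div_sq_add_one_le ?_
        have := hs.1
        have := hs.2
        push_cast at this
        rw [abs_le]; constructor <;> linarith)
    simpa using h
  refine (Finset.sum_le_sum h1).trans ?_
  rw [intervalIntegral.sum_integral_adjacent_intervals
    (fun k _ => hc.intervalIntegrable _ _), intervalIntegral.integral_const_mul]
  linarith [integral_one_div_sub_sq_add_one_le t ((0 : ℕ) : ℝ) (n : ℝ)]

/-- The Poisson part of the Cauchy transform is bounded on `ℓ ^ r`. -/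
theorem integral_cauchyTransform_re_rpow_le {n : ℕ} {x : Fin n → ℝ} (hx : ∀ j, 0 ≤ x j)
    {r : ℝ} (hr : 1 < r) {a b : ℝ} (hab : a ≤ b) :
    ∫ t in a..b, (cauchyTransform x (t + Complex.I)).re ^ r ≤
      (3 * Real.pi) ^ (r - 1) * Real.pi * ∑ j, x j ^ r := by
  have hPc : ∀ j : Fin n, Continuous fun t : ℝ => 1 / ((t - (j : ℕ)) ^ 2 + 1) := fun j =>
    continuous_const.div (by fun_prop) fun s => by positivity
  have hpt : ∀ t : ℝ, (cauchyTransform x (t + Complex.I)).re ^ r ≤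
      (3 * Real.pi) ^ (r - 1) * ∑ j, x j ^ r * (1 / ((t - (j : ℕ)) ^ 2 + 1)) := by
    intro t
    rw [cauchyTransform_add_I_re]
    set w : Fin n → ℝ := fun j => 1 / ((t - (j : ℕ)) ^ 2 + 1) with hw
    have hw0 : ∀ j, 0 ≤ w j := fun j => by positivity
    -- Weighted Hölder with the kernel as weight: its total mass in `j` gives `(3 * π) ^ (r - 1)`,
    -- and the later integration in `t` gives the factor `π`.
    have h1 := Real.inner_le_weight_mul_Lp_of_nonneg Finset.univ hr.le w x hw0 hx
    have hs0 : 0 ≤ ∑ j, w j := Finset.sum_nonneg fun j _ => hw0 j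
    have hs1 : ∑ j, w j ≤ 3 * Real.pi := sum_one_div_sub_sq_add_one_le n t
    have hq0 : 0 ≤ ∑ j, w j * x j ^ r :=
      Finset.sum_nonneg fun j _ => mul_nonneg (hw0 j) (Real.rpow_nonneg (hx j) r)
    have h2 := Real.rpow_le_rpow
      (Finset.sum_nonneg fun j _ => mul_nonneg (hw0 j) (hx j)) h1 (show 0 ≤ r by linarith)
    rw [Real.mul_rpow (Real.rpow_nonneg hs0 _) (Real.rpow_nonneg hq0 _), ← Real.rpow_mul hs0,
      ← Real.rpow_mul hq0, inv_mul_cancel₀ (by linarith), Real.rpow_one,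
      show (1 - r⁻¹) * r = r - 1 by field_simp] at h2
    calc (∑ j, x j * w j) ^ r = (∑ j, w j * x j) ^ r := by simp only [mul_comm]
      _ ≤ _ := h2
      _ ≤ (3 * Real.pi) ^ (r - 1) * ∑ j, w j * x j ^ r := by
          gcongr
      _ = _ := by simp only [hw, mul_comm]
  have hc1 : Continuous fun t : ℝ => (cauchyTransform x (t + Complex.I)).re ^ r := by
    simp only [cauchyTransform_add_I_re]
    refine Continuous.rpow_const ?_ fun t => Or.inr (by linarith)
    exact continuous_finsetSum _ fun j _ => continuous_const.mul (hPc j)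
  have hc2 : ∀ j : Fin n, Continuous fun t : ℝ => x j ^ r * (1 / ((t - (j : ℕ)) ^ 2 + 1)) :=
    fun j => continuous_const.mul (hPc j)
  have h := intervalIntegral.integral_mono_on (μ := MeasureTheory.volume) hab
    (hc1.intervalIntegrable a b)
    ((continuous_const.mul (continuous_finsetSum _ fun j _ => hc2 j)).intervalIntegrable a b)
    (fun t _ => hpt t)
  refine h.trans ?_
  simp only [Pi.mul_apply]
  rw [intervalIntegral.integral_const_mul, intervalIntegral.integral_finsetSum
    (fun j _ => (hc2 j).intervalIntegrable a b), mul_assoc]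
  gcongr
  rw [Finset.mul_sum]
  refine Finset.sum_le_sum fun j _ => ?_
  rw [intervalIntegral.integral_const_mul, mul_comm]
  exact mul_le_mul_of_nonneg_right (integral_one_div_sub_sq_add_one_le _ _ _)
    (Real.rpow_nonneg (hx j) r)

/-! ### The smoothed Hilbert matrix on `ℓ ^ r` -/

/-- A smoothed Hilbert matrix, with entries the means over `[i, i + 1]` of the conjugate
Poisson kernel centred at `j`. -/
def hilbertMatrix (n : ℕ) : Matrix (Fin n) (Fin n) ℝ :=
  Matrix.of fun i j => ∫ t in ((i : ℕ) : ℝ)..((i : ℕ) : ℝ) + 1,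
    (t - (j : ℕ)) / ((t - (j : ℕ)) ^ 2 + 1)

theorem continuous_div_sq_add_one : Continuous fun t : ℝ => t / (t ^ 2 + 1) :=
  continuous_id.div (by fun_prop) fun s => by positivity

theorem continuous_cauchyTransform_add_I_im {n : ℕ} (x : Fin n → ℝ) :
    Continuous fun t : ℝ => (cauchyTransform x (t + Complex.I)).im := by
  simp only [cauchyTransform_add_I_im]
  refine continuous_finsetSum _ fun j _ => continuous_const.mul ?_
  exact continuous_div_sq_add_one.comp (continuous_id.sub continuous_const)

theorem continuous_cauchyTransform_add_I {n : ℕ} (x : Fin n → ℝ) :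
    Continuous fun t : ℝ => cauchyTransform x (t + Complex.I) := by
  refine continuous_iff_continuousAt.2 fun t => ?_
  exact (differentiableAt_cauchyTransform x (z := t + Complex.I) (by simp)).continuousAt.comp
    (f := fun t : ℝ => (t : ℂ) + Complex.I) (by fun_prop)

theorem hilbertMatrix_apply_eq_integral_sub (n : ℕ) (i j : Fin n) :
    hilbertMatrix n i j = ∫ t in (((i : ℕ) : ℝ) - (j : ℕ))..(((i : ℕ) : ℝ) - (j : ℕ)) + 1,
      t / (t ^ 2 + 1) := by
  rw [hilbertMatrix, Matrix.of_apply,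
    intervalIntegral.integral_comp_sub_right (fun t : ℝ => t / (t ^ 2 + 1)), add_sub_right_comm]

/-- Entries depend only on `i - j`, so reversing the order of the indices transposes the matrix.
This serves duality in place of antisymmetry, which averaging over `[i, i + 1]` breaks. -/
theorem hilbertMatrix_rev_rev (n : ℕ) (i j : Fin n) :
    hilbertMatrix n i.rev j.rev = hilbertMatrix n j i := by
  simp only [hilbertMatrix_apply_eq_integral_sub]
  have h : ((i.rev : ℕ) : ℝ) - (j.rev : ℕ) = (j : ℕ) - (i : ℕ) := by
    rw [Fin.val_rev, Fin.val_rev, Nat.cast_sub (by omega), Nat.cast_sub (by omega)]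
    push_cast
    ring
  rw [h]

theorem hilbertMatrix_mulVec {n : ℕ} (x : Fin n → ℝ) (i : Fin n) :
    (hilbertMatrix n *ᵥ x) i = ∫ t in ((i : ℕ) : ℝ)..((i : ℕ) : ℝ) + 1,
      (cauchyTransform x (t + Complex.I)).im := by
  simp only [cauchyTransform_add_I_im, Matrix.mulVec, dotProduct, hilbertMatrix, Matrix.of_apply]
  rw [intervalIntegral.integral_finsetSum]
  · refine Finset.sum_congr rfl fun j _ => ?_
    rw [intervalIntegral.integral_const_mul, mul_comm]
  · intro j _
    refine (continuous_const.mul ?_).intervalIntegrable _ _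
    exact continuous_div_sq_add_one.comp (continuous_id.sub continuous_const)

/-- Jensen's inequality: an interval of length one is a probability space. -/
theorem abs_integral_rpow_le_integral_abs_rpow {f : ℝ → ℝ} (hf : Continuous f) {r : ℝ}
    (hr : 1 ≤ r) (a : ℝ) :
    |∫ t in a..a + 1, f t| ^ r ≤ ∫ t in a..a + 1, |f t| ^ r := by
  have hle : a ≤ a + 1 := by linarith
  have h1 : |∫ t in a..a + 1, f t| ≤ ∫ t in a..a + 1, |f t| :=
    intervalIntegral.abs_integral_le_integral_abs hle
  have hg : Continuous fun t => |f t| ^ r := hf.abs.rpow_const fun t => Or.inr (by linarith)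
  refine (Real.rpow_le_rpow (abs_nonneg _) h1 (by linarith)).trans ?_
  rw [intervalIntegral.integral_of_le hle, intervalIntegral.integral_of_le hle]
  have : MeasureTheory.IsProbabilityMeasure
      (MeasureTheory.volume.restrict (Set.Ioc a (a + 1))) := ⟨by simp⟩
  exact (convexOn_rpow hr).map_integral_le
    (continuousOn_id.rpow_const fun t _ => Or.inr (by linarith)) isClosed_Ici
    (Eventually.of_forall fun t => abs_nonneg (f t))
    ((intervalIntegrable_iff_integrableOn_Ioc_of_le hle).1 (hf.abs.intervalIntegrable _ _))
    ((intervalIntegrable_iff_integrableOn_Ioc_of_le hle).1 (hg.intervalIntegrable _ _))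

/-- The averaging intervals `[i, i + 1]` tile `[0, n]`, so Jensen turns the discrete sum into one
integral with no loss. -/
theorem sum_abs_hilbertMatrix_mulVec_rpow_le_integral {n : ℕ} (x : Fin n → ℝ) {r : ℝ}
    (hr : 1 ≤ r) {R : ℝ} (hRn : (n : ℝ) ≤ R) :
    ∑ i, |(hilbertMatrix n *ᵥ x) i| ^ r ≤
      ∫ t in (-R)..R, ‖cauchyTransform x (t + Complex.I)‖ ^ r := by
  have hv := continuous_cauchyTransform_add_I_im x
  have hvr : Continuous fun t : ℝ => |(cauchyTransform x (t + Complex.I)).im| ^ r :=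
    hv.abs.rpow_const fun t => Or.inr (by linarith)
  have hFr : Continuous fun t : ℝ => ‖cauchyTransform x (t + Complex.I)‖ ^ r :=
    (continuous_cauchyTransform_add_I x).norm.rpow_const fun t => Or.inr (by linarith)
  have hn0 : (0 : ℝ) ≤ n := Nat.cast_nonneg n
  calc ∑ i, |(hilbertMatrix n *ᵥ x) i| ^ r
      ≤ ∑ i : Fin n, ∫ t in ((i : ℕ) : ℝ)..((i : ℕ) : ℝ) + 1,
          |(cauchyTransform x (t + Complex.I)).im| ^ r := by
        refine Finset.sum_le_sum fun i _ => ?_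
        rw [hilbertMatrix_mulVec]
        exact abs_integral_rpow_le_integral_abs_rpow hv hr _
    _ = ∫ t in (0 : ℝ)..n, |(cauchyTransform x (t + Complex.I)).im| ^ r := by
        rw [Fin.sum_univ_eq_sum_range (fun i : ℕ => ∫ t in (i : ℝ)..(i : ℝ) + 1,
          |(cauchyTransform x (t + Complex.I)).im| ^ r) n]
        have h := intervalIntegral.sum_integral_adjacent_intervals (n := n)
          (μ := MeasureTheory.volume) (a := fun k : ℕ => (k : ℝ))
          (fun k _ => hvr.intervalIntegrable (k : ℝ) ((k + 1 : ℕ) : ℝ))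
        push_cast at h
        exact h
    _ ≤ ∫ t in (0 : ℝ)..n, ‖cauchyTransform x (t + Complex.I)‖ ^ r :=
        intervalIntegral.integral_mono_on hn0 (hvr.intervalIntegrable _ _)
          (hFr.intervalIntegrable _ _) fun t _ =>
            Real.rpow_le_rpow (abs_nonneg _) (Complex.abs_im_le_norm _) (by linarith)
    _ ≤ _ := intervalIntegral.integral_mono_interval (by linarith) hn0 hRn
        (Eventually.of_forall fun t => Real.rpow_nonneg (norm_nonneg _) r)
        (hFr.intervalIntegrable _ _)

theorem tendsto_mul_div_half_rpow {r : ℝ} (hr : 1 < r) {S : ℝ} (hS : 0 ≤ S) :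
    Tendsto (fun R : ℝ => 4 * R * (S / (R / 2)) ^ r) atTop (𝓝 0) := by
  have h := (tendsto_rpow_neg_atTop (show 0 < r - 1 by linarith)).const_mul (4 * (S * 2) ^ r)
  rw [mul_zero] at h
  refine h.congr' ?_
  filter_upwards [eventually_gt_atTop 0] with R hR
  rw [show S / (R / 2) = S * 2 / R by field_simp, Real.div_rpow (by positivity) hR.le, neg_sub,
    Real.rpow_sub hR, Real.rpow_one]
  ring

/-- The pointwise inequality is integrated along `Im z = 1` over `[-R, R]`. As `R → ∞` the contour
term, of order `R ^ (1 - r)`, disappears and only the Poisson part remains. -/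
theorem exists_sum_hilbertMatrix_rpow_le_of_nonneg {r : ℝ} (hr : 1 < r) (hr2 : r ≤ 2) :
    ∃ C : ℝ, 0 ≤ C ∧ ∀ (n : ℕ) (x : Fin n → ℝ), (∀ j, 0 ≤ x j) →
      ∑ i, |(hilbertMatrix n *ᵥ x) i| ^ r ≤ C * ∑ j, x j ^ r := by
  obtain ⟨A, B, hA, hB, h⟩ := exists_norm_rpow_le_re_rpow_sub_re_cpow hr hr2
  refine ⟨A * ((3 * Real.pi) ^ (r - 1) * Real.pi), by positivity, fun n x hx => ?_⟩
  have hr0 : r ≠ 0 := by linarith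
  by_cases hx0 : x = 0
  · simp [hx0, Real.zero_rpow hr0]
  have hS : 0 ≤ ∑ j, x j := Finset.sum_nonneg fun j _ => hx j
  have hlim := ((tendsto_mul_div_half_rpow hr hS).const_mul B).const_add
    (A * ((3 * Real.pi) ^ (r - 1) * Real.pi) * ∑ j, x j ^ r)
  rw [mul_zero, add_zero] at hlim
  refine ge_of_tendsto hlim ?_
  filter_upwards [eventually_gt_atTop 0, eventually_ge_atTop (2 * (n : ℝ))] with R hR hRn
  have hn0 : (0 : ℝ) ≤ n := Nat.cast_nonneg n
  have hF := continuous_cauchyTransform_add_I x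
  have hpos : ∀ t : ℝ, 0 < (cauchyTransform x (t + Complex.I)).re := fun t =>
    cauchyTransform_re_pos hx hx0 (by simp)
  have hFr : Continuous fun t : ℝ => ‖cauchyTransform x (t + Complex.I)‖ ^ r :=
    hF.norm.rpow_const fun t => Or.inr (by linarith)
  have hu : Continuous fun t : ℝ => (cauchyTransform x (t + Complex.I)).re ^ r :=
    (Complex.continuous_re.comp hF).rpow_const fun t => Or.inr (by linarith)
  have hG : Continuous fun t : ℝ => cauchyTransform x (t + Complex.I) ^ (r : ℂ) :=
    hF.cpow continuous_const fun t => Or.inl (hpos t)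
  have hGre : Continuous fun t : ℝ => (cauchyTransform x (t + Complex.I) ^ (r : ℂ)).re :=
    Complex.continuous_re.comp hG
  have hAu : Continuous fun t : ℝ => A * (cauchyTransform x (t + Complex.I)).re ^ r :=
    continuous_const.mul hu
  have hBG : Continuous fun t : ℝ => B * (cauchyTransform x (t + Complex.I) ^ (r : ℂ)).re :=
    continuous_const.mul hGre
  have h1 := sum_abs_hilbertMatrix_mulVec_rpow_le_integral x hr.le
    (show (n : ℝ) ≤ R by linarith)
  have h2 : ∫ t in (-R)..R, ‖cauchyTransform x (t + Complex.I)‖ ^ r ≤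
      ∫ t in (-R)..R, (A * (cauchyTransform x (t + Complex.I)).re ^ r -
        B * (cauchyTransform x (t + Complex.I) ^ (r : ℂ)).re) :=
    intervalIntegral.integral_mono_on (by linarith) (hFr.intervalIntegrable _ _)
      ((hAu.sub hBG).intervalIntegrable _ _)
      fun t _ => h _ (hpos t)
  rw [intervalIntegral.integral_sub (hAu.intervalIntegrable _ _)
    (hBG.intervalIntegrable _ _), intervalIntegral.integral_const_mul,
    intervalIntegral.integral_const_mul] at h2
  have h3 := integral_cauchyTransform_re_rpow_le hx hr (show -R ≤ R by linarith)
  have h4 : -(∫ t in (-R)..R, (cauchyTransform x (t + Complex.I) ^ (r : ℂ)).re) ≤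
      4 * R * ((∑ j, x j) / (R / 2)) ^ r := by
    have h5 : (∫ t in (-R)..R, (cauchyTransform x (t + Complex.I) ^ (r : ℂ)).re) =
        (∫ t in (-R)..R, cauchyTransform x (t + Complex.I) ^ (r : ℂ)).re := by
      have := intervalIntegral.intervalIntegral_re (𝕜 := ℂ) (μ := MeasureTheory.volume)
        (hG.intervalIntegrable (-R) R)
      exact this
    rw [h5]
    exact ((neg_le_abs _).trans (Complex.abs_re_le_norm _)).trans
      (norm_integral_cauchyTransform_cpow_le hx hx0 hr hR hRn)
  have h6 := mul_le_mul_of_nonneg_left h3 hA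
  have h7 := mul_le_mul_of_nonneg_left h4 hB
  linarith

theorem abs_sub_rpow_le {r : ℝ} (hr : 0 ≤ r) (a b : ℝ) :
    |a - b| ^ r ≤ 2 ^ r * (|a| ^ r + |b| ^ r) := by
  have ha := Real.rpow_nonneg (abs_nonneg a) r
  have hb := Real.rpow_nonneg (abs_nonneg b) r
  have key : ∀ m : ℝ, 0 ≤ m → |a - b| ≤ 2 * m → |a - b| ^ r ≤ 2 ^ r * m ^ r := fun m hm h => by
    rw [← Real.mul_rpow (by norm_num) hm]
    exact Real.rpow_le_rpow (abs_nonneg _) h hr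
  have h2 : (0 : ℝ) < 2 ^ r := by positivity
  have htri := abs_sub a b
  rcases le_total |a| |b| with h | h
  · have := key |b| (abs_nonneg b) (by linarith)
    nlinarith
  · have := key |a| (abs_nonneg a) (by linarith)
    nlinarith

theorem exists_sum_hilbertMatrix_rpow_le_of_le_two {r : ℝ} (hr : 1 < r) (hr2 : r ≤ 2) :
    ∃ C : ℝ, 0 ≤ C ∧ ∀ (n : ℕ) (x : Fin n → ℝ),
      ∑ i, |(hilbertMatrix n *ᵥ x) i| ^ r ≤ C * ∑ j, |x j| ^ r := by
  obtain ⟨C, hC, h⟩ := exists_sum_hilbertMatrix_rpow_le_of_nonneg hr hr2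
  refine ⟨2 ^ r * (C + C), by positivity, fun n x => ?_⟩
  have hr0 : 0 ≤ r := by linarith
  set y : Fin n → ℝ := fun j => max (x j) 0 with hy
  set z : Fin n → ℝ := fun j => max (-x j) 0 with hz
  have hxyz : x = y - z := by
    ext j
    simp only [hy, hz, Pi.sub_apply]
    rcases le_total (x j) 0 with h | h
    · rw [max_eq_right h, max_eq_left (by linarith)]; ring
    · rw [max_eq_left h, max_eq_right (by linarith)]; ring
  have hy1 : ∑ j, y j ^ r ≤ ∑ j, |x j| ^ r := Finset.sum_le_sum fun j _ =>
    Real.rpow_le_rpow (le_max_right _ _) (max_le (le_abs_self _) (abs_nonneg _)) hr0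
  have hz1 : ∑ j, z j ^ r ≤ ∑ j, |x j| ^ r := Finset.sum_le_sum fun j _ =>
    Real.rpow_le_rpow (le_max_right _ _) (max_le (neg_le_abs _) (abs_nonneg _)) hr0
  have hHy := h n y fun j => le_max_right _ _
  have hHz := h n z fun j => le_max_right _ _
  calc ∑ i, |(hilbertMatrix n *ᵥ x) i| ^ r
      ≤ ∑ i, 2 ^ r * (|(hilbertMatrix n *ᵥ y) i| ^ r + |(hilbertMatrix n *ᵥ z) i| ^ r) := by
        refine Finset.sum_le_sum fun i _ => ?_
        rw [hxyz, Matrix.mulVec_sub, Pi.sub_apply]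
        exact abs_sub_rpow_le hr0 _ _
    _ = 2 ^ r * (∑ i, |(hilbertMatrix n *ᵥ y) i| ^ r +
          ∑ i, |(hilbertMatrix n *ᵥ z) i| ^ r) := by
        rw [← Finset.mul_sum, Finset.sum_add_distrib]
    _ ≤ 2 ^ r * (C * ∑ j, |x j| ^ r + C * ∑ j, |x j| ^ r) := by
        gcongr
        · exact hHy.trans (mul_le_mul_of_nonneg_left hy1 hC)
        · exact hHz.trans (mul_le_mul_of_nonneg_left hz1 hC)
    _ = _ := by ring

theorem transpose_hilbertMatrix_mulVec {n : ℕ} (z : Fin n → ℝ) (j : Fin n) :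
    ((hilbertMatrix n)ᵀ *ᵥ z) j = (hilbertMatrix n *ᵥ (z ∘ Fin.rev)) j.rev := by
  simp only [Matrix.mulVec, dotProduct, Matrix.transpose_apply, Function.comp]
  rw [← Equiv.sum_comp Fin.revPerm (fun i => hilbertMatrix n j.rev i * z i.rev)]
  simp [hilbertMatrix_rev_rev]

/-- The matrices `hilbertMatrix n` are bounded on `ℓ ^ r` uniformly in `n`, for `1 < r < ∞`. -/
theorem exists_sum_hilbertMatrix_rpow_le {r : ℝ} (hr : 1 < r) :
    ∃ C : ℝ, 0 ≤ C ∧ ∀ (n : ℕ) (x : Fin n → ℝ),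
      ∑ i, |(hilbertMatrix n *ᵥ x) i| ^ r ≤ C * ∑ j, |x j| ^ r := by
  rcases le_total r 2 with hr2 | hr2
  · exact exists_sum_hilbertMatrix_rpow_le_of_le_two hr hr2
  -- Duality: for `r ≥ 2` the conjugate exponent `s` lies in `(1, 2]`, and the transpose is bounded
  -- on `ℓ ^ s` by reversal.
  have hconj := Real.HolderConjugate.conjExponent hr
  set s := r.conjExponent with hs
  have hr0 : 0 < r := by linarith
  have hs1 : 1 < s := hconj.symm.lt
  have hs0 : 0 < s := by linarith
  have hs2 : s ≤ 2 := by
    rw [hs, Real.conjExponent, div_le_iff₀ (by linarith)]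
    linarith
  have hrs : (r - 1) * s = r := hconj.sub_one_mul_conj
  obtain ⟨C, hC, h⟩ := exists_sum_hilbertMatrix_rpow_le_of_le_two hs1 hs2
  refine ⟨C ^ (r / s), by positivity, fun n x => ?_⟩
  set y := hilbertMatrix n *ᵥ x with hy
  -- The norming vector of `y`: `z i * y i = |y i| ^ r` and `|z i| ^ s ≤ |y i| ^ r`.
  set z : Fin n → ℝ := fun i => SignType.sign (y i) * |y i| ^ (r - 1) with hz
  set Y := ∑ i, |y i| ^ r with hY
  set X := ∑ j, |x j| ^ r with hX
  have hX0 : 0 ≤ X := Finset.sum_nonneg fun j _ => Real.rpow_nonneg (abs_nonneg _) r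
  have hY0 : 0 ≤ Y := Finset.sum_nonneg fun j _ => Real.rpow_nonneg (abs_nonneg _) r
  rcases hY0.eq_or_lt with hY00 | hYpos
  · rw [← hY00]; positivity
  have hzs : ∑ i, |z i| ^ s ≤ Y := Finset.sum_le_sum fun i _ => by
    have h0 : |(SignType.sign (y i) : ℝ)| ≤ 1 := by
      rcases lt_trichotomy (y i) 0 with h | h | h <;> simp [h]
    have h1 : |z i| ≤ |y i| ^ (r - 1) := by
      rw [hz]
      simp only [abs_mul, abs_of_nonneg (Real.rpow_nonneg (abs_nonneg (y i)) (r - 1))]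
      exact mul_le_of_le_one_left (Real.rpow_nonneg (abs_nonneg (y i)) _) h0
    calc |z i| ^ s ≤ (|y i| ^ (r - 1)) ^ s := Real.rpow_le_rpow (abs_nonneg _) h1 hs0.le
      _ = |y i| ^ r := by rw [← Real.rpow_mul (abs_nonneg _), hrs]
  have hzy : Y = ∑ i, z i * y i := Finset.sum_congr rfl fun i _ => by
    rw [hz]
    dsimp only
    rw [mul_right_comm, sign_mul_self]
    rcases (abs_nonneg (y i)).eq_or_lt with h | h
    · rw [← h, Real.zero_rpow hr0.ne', zero_mul]
    · rw [Real.rpow_sub_one h.ne', mul_div_cancel₀ _ h.ne']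
  have hdual : ∑ i, z i * y i = ∑ j, x j * ((hilbertMatrix n)ᵀ *ᵥ z) j := by
    have h1 : z ⬝ᵥ (hilbertMatrix n *ᵥ x) = x ⬝ᵥ ((hilbertMatrix n)ᵀ *ᵥ z) := by
      rw [Matrix.dotProduct_mulVec, Matrix.mulVec_transpose, dotProduct_comm]
    exact h1
  have hT : ∑ j, |((hilbertMatrix n)ᵀ *ᵥ z) j| ^ s ≤ C * Y := by
    simp only [transpose_hilbertMatrix_mulVec]
    have h1 := Equiv.sum_comp Fin.revPerm
      (fun j => |(hilbertMatrix n *ᵥ (z ∘ Fin.rev)) j| ^ s)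
    have h2 := Equiv.sum_comp Fin.revPerm (fun j => |z j| ^ s)
    simp only [Fin.revPerm_apply] at h1 h2
    rw [h1]
    refine (h n (z ∘ Fin.rev)).trans ?_
    simp only [Function.comp, h2]
    exact mul_le_mul_of_nonneg_left hzs hC
  have hH := Real.inner_le_Lp_mul_Lq Finset.univ x ((hilbertMatrix n)ᵀ *ᵥ z) hconj
  have hmain : Y ≤ X ^ (1 / r) * (C ^ (1 / s) * Y ^ (1 / s)) := by
    rw [← Real.mul_rpow hC hY0]
    calc Y = ∑ j, x j * ((hilbertMatrix n)ᵀ *ᵥ z) j := hzy.trans hdual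
      _ ≤ _ := hH
      _ ≤ _ := by gcongr
  have hYs : 0 < Y ^ (1 / s) := Real.rpow_pos_of_pos hYpos _
  have hsplit : Y = Y ^ (1 / r) * Y ^ (1 / s) := by
    rw [← Real.rpow_add hYpos, one_div, one_div, hconj.inv_add_inv_eq_one, Real.rpow_one]
  have hroot : Y ^ (1 / r) ≤ X ^ (1 / r) * C ^ (1 / s) := by
    refine le_of_mul_le_mul_right ?_ hYs
    rw [← hsplit, mul_assoc]
    exact hmain
  have hfin := Real.rpow_le_rpow (Real.rpow_nonneg hY0 _) hroot hr0.le
  rw [Real.mul_rpow (Real.rpow_nonneg hX0 _) (Real.rpow_nonneg hC _), ← Real.rpow_mul hY0,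
    ← Real.rpow_mul hX0, ← Real.rpow_mul hC, one_div_mul_cancel hr0.ne', Real.rpow_one,
    Real.rpow_one, one_div_mul_eq_div] at hfin
  linarith

/-- For `j ≤ i` the interval of integration lies in `t ≥ 0`, so nothing cancels. The diagonal, where
`t / (t ^ 2 + 1) ≥ t / 2` integrates to `1 / 4`, accounts for the constant `4`. -/
theorem one_div_le_hilbertMatrix {n : ℕ} {i j : Fin n} (hij : j ≤ i) :
    1 / (4 * (((i : ℕ) : ℝ) - (j : ℕ) + 1)) ≤ hilbertMatrix n i j := by
  rw [hilbertMatrix_apply_eq_integral_sub, ← Nat.cast_sub hij]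
  set d := (i : ℕ) - (j : ℕ) with hd
  have hk := continuous_div_sq_add_one
  rcases Nat.eq_zero_or_pos d with h0 | hpos
  · have h1 : ∫ t in (0 : ℝ)..1, t / 2 ≤ ∫ t in (0 : ℝ)..1, t / (t ^ 2 + 1) := by
      refine intervalIntegral.integral_mono_on zero_le_one
        ((continuous_id.div_const 2).intervalIntegrable _ _) (hk.intervalIntegrable _ _)
        fun t ht => ?_
      refine div_le_div_of_nonneg_left ht.1 (by positivity) ?_
      nlinarith [ht.1, ht.2]
    rw [intervalIntegral.integral_div, integral_id] at h1
    rw [h0]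
    norm_num at h1 ⊢
    exact h1
  · have hd1 : (1 : ℝ) ≤ d := by exact_mod_cast hpos
    have h1 : ∫ t in (d : ℝ)..(d : ℝ) + 1, 1 / (4 * ((d : ℝ) + 1)) ≤
        ∫ t in (d : ℝ)..(d : ℝ) + 1, t / (t ^ 2 + 1) := by
      refine intervalIntegral.integral_mono_on (by linarith) intervalIntegrable_const
        (hk.intervalIntegrable _ _) fun t ht => ?_
      have ht1 := ht.1
      have ht2 := ht.2
      rw [div_le_div_iff₀ (by positivity) (by positivity)]
      nlinarith
    simpa using h1

/-! ### Rearrangements and normalized finite `ℓ ^ p` norms -/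

theorem rearrangement_comp_perm (x : ℕ → ℝ) (σ : Equiv.Perm ℕ) :
    rearrangement (x ∘ σ) = rearrangement x := by
  have h : ∀ s : ℝ, {j : ℕ | s < |(x ∘ σ) j|}.encard = {j : ℕ | s < |x j|}.encard := fun s =>
    Set.encard_preimage_of_bijective σ.bijective {j : ℕ | s < |x j|}
  funext i
  simp only [rearrangement, h]

theorem finLpNorm_nonneg (p : ℝ≥0∞) [Fact (1 ≤ p)] {m : ℕ} (a : Fin m → ℝ) :
    0 ≤ finLpNorm p a := norm_nonneg _

theorem finLpNorm_smul (p : ℝ≥0∞) [Fact (1 ≤ p)] {m : ℕ} (c : ℝ) (a : Fin m → ℝ) :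
    finLpNorm p (c • a) = |c| * finLpNorm p a := by
  unfold finLpNorm
  rw [WithLp.toLp_smul, norm_smul, Real.norm_eq_abs]

theorem finLpNorm_const (p : ℝ≥0∞) [Fact (1 ≤ p)] {m : ℕ} {c : ℝ} (hc : 0 ≤ c) :
    finLpNorm p (fun _ : Fin m => c) = c * finLpNorm p (1 : Fin m → ℝ) := by
  rw [← abs_of_nonneg hc, ← finLpNorm_smul]
  congr 1
  ext
  simp [abs_of_nonneg hc]

theorem finLpNorm_comp_perm (p : ℝ≥0∞) [Fact (1 ≤ p)] {m : ℕ} (a : Fin m → ℝ)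
    (σ : Equiv.Perm (Fin m)) : finLpNorm p (a ∘ σ) = finLpNorm p a := by
  unfold finLpNorm
  rw [← (LinearIsometryEquiv.piLpCongrLeft p ℝ ℝ σ).norm_map]
  congr 1
  ext i
  simp

theorem finLpNorm_eq_sum {p : ℝ≥0∞} (hp : 0 < p.toReal) {m : ℕ} (a : Fin m → ℝ) :
    finLpNorm p a = (∑ k, |a k| ^ p.toReal) ^ (1 / p.toReal) := by
  unfold finLpNorm
  rw [PiLp.norm_eq_sum hp]
  simp

theorem abs_le_finLpNorm_top {m : ℕ} (a : Fin m → ℝ) (k : Fin m) :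
    |a k| ≤ finLpNorm ∞ a := by
  have h := PiLp.norm_apply_le (p := ∞) (WithLp.toLp ∞ a : PiLp ∞ (fun _ : Fin m => ℝ)) k
  simpa [finLpNorm] using h

theorem one_le_finLpNorm_one (p : ℝ≥0∞) [Fact (1 ≤ p)] {n : ℕ} (hn : 1 ≤ n) :
    1 ≤ finLpNorm p (1 : Fin n → ℝ) := by
  have h := PiLp.norm_apply_le (WithLp.toLp p 1 : PiLp p (fun _ : Fin n => ℝ)) ⟨0, hn⟩
  simpa [finLpNorm] using h

theorem finLpNorm_top_one {n : ℕ} (hn : 1 ≤ n) : finLpNorm ∞ (1 : Fin n → ℝ) = 1 := by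
  refine le_antisymm ?_ (one_le_finLpNorm_one ∞ hn)
  unfold finLpNorm
  rw [PiLp.norm_toLp]
  simp [pi_norm_le_iff_of_nonneg]

theorem finLpNorm_one_eq {p : ℝ≥0∞} (hp : 0 < p.toReal) (n : ℕ) :
    finLpNorm p (1 : Fin n → ℝ) = (n : ℝ) ^ (1 / p.toReal) := by
  simp [finLpNorm_eq_sum hp]

/-- Monotonicity of the normalized `ℓ ^ s` means for finite exponents. -/
theorem sum_rpow_mean_le {s t : ℝ} (hs : 0 < s) (hst : s ≤ t) {n : ℕ} (hn : 1 ≤ n)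
    (a : Fin n → ℝ) :
    (∑ k, |a k| ^ s) ^ (1 / s) * (n : ℝ) ^ (1 / t) ≤
      (n : ℝ) ^ (1 / s) * (∑ k, |a k| ^ t) ^ (1 / t) := by
  have ht : 0 < t := hs.trans_le hst
  have hn0 : (0 : ℝ) < n := by exact_mod_cast hn
  have hS : 0 ≤ ∑ k, |a k| ^ s := Finset.sum_nonneg fun k _ => Real.rpow_nonneg (abs_nonneg _) _
  have hT : 0 ≤ ∑ k, |a k| ^ t := Finset.sum_nonneg fun k _ => Real.rpow_nonneg (abs_nonneg _) _
  have h := Real.rpow_arith_mean_le_arith_mean_rpow Finset.univ (fun _ : Fin n => (1 : ℝ) / n)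
    (fun k => |a k| ^ s) (fun _ _ => by positivity) (by simp [hn0.ne'])
    (fun k _ => Real.rpow_nonneg (abs_nonneg _) _) ((one_le_div hs).2 hst)
  rw [← Finset.mul_sum, ← Finset.mul_sum] at h
  have hexp : ∀ k, (|a k| ^ s) ^ (t / s) = |a k| ^ t := fun k => by
    rw [← Real.rpow_mul (abs_nonneg _), mul_div_cancel₀ _ hs.ne']
  simp only [hexp, one_div_mul_eq_div] at h
  have h2 := Real.rpow_le_rpow (Real.rpow_nonneg (by positivity) _) h
    (show 0 ≤ 1 / t by positivity)
  rw [← Real.rpow_mul (by positivity), show t / s * (1 / t) = 1 / s by field_simp,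
    Real.div_rpow hS hn0.le, Real.div_rpow hT hn0.le,
    div_le_div_iff₀ (Real.rpow_pos_of_pos hn0 _) (Real.rpow_pos_of_pos hn0 _)] at h2
  linarith

/-- The matrices `hilbertMatrix n` map the normalized `ℓ ^ p` spaces to the normalized `ℓ ^ q`
spaces, uniformly in `n`. -/
theorem exists_finLpNorm_hilbertMatrix_le (p q : ℝ≥0∞) [Fact (1 ≤ p)] [Fact (1 ≤ q)]
    (hp : p ≠ 1) (hq : q ≠ ∞) (hqp : q ≤ p) :
    ∃ C : ℝ, 0 < C ∧ ∀ n : ℕ, 1 ≤ n → ∀ x : Fin n → ℝ,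
      finLpNorm q (hilbertMatrix n *ᵥ x) * finLpNorm p (1 : Fin n → ℝ) ≤
        C * (finLpNorm q (1 : Fin n → ℝ) * finLpNorm p x) := by
  have hp1 : 1 < p := lt_of_le_of_ne Fact.out hp.symm
  have hq1 : (1 : ℝ) ≤ q.toReal := by
    rw [← ENNReal.toReal_one]
    exact ENNReal.toReal_mono hq Fact.out
  have hq0 : 0 < q.toReal := by linarith
  -- An intermediate exponent in `[q, p]` with `1 < r < ∞`: `p` itself when finite, and `max q 2`
  -- when `p = ∞`. Here `p ≠ 1` and `q ≠ ∞` are indispensable.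
  obtain ⟨r, hr1, hqr, hrp⟩ : ∃ r : ℝ, 1 < r ∧ q.toReal ≤ r ∧
      ∀ n : ℕ, 1 ≤ n → ∀ x : Fin n → ℝ,
        (∑ k, |x k| ^ r) ^ (1 / r) * finLpNorm p (1 : Fin n → ℝ) ≤
          (n : ℝ) ^ (1 / r) * finLpNorm p x := by
    by_cases hpt : p = ∞
    · subst hpt
      refine ⟨max q.toReal 2, lt_max_of_lt_right (by norm_num), le_max_left _ _,
        fun n hn x => ?_⟩
      set r := max q.toReal 2
      have hr0 : 0 < r := lt_max_of_lt_left hq0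
      rw [finLpNorm_top_one hn, mul_one]
      have hN := finLpNorm_nonneg ∞ x
      have h1 : ∑ k, |x k| ^ r ≤ n * finLpNorm ∞ x ^ r := by
        refine (Finset.sum_le_sum fun k _ =>
          Real.rpow_le_rpow (abs_nonneg _) (abs_le_finLpNorm_top x k) hr0.le).trans ?_
        simp
      refine (Real.rpow_le_rpow
        (Finset.sum_nonneg fun k _ => Real.rpow_nonneg (abs_nonneg _) _) h1
        (show 0 ≤ 1 / r by positivity)).trans (le_of_eq ?_)
      rw [Real.mul_rpow (Nat.cast_nonneg n) (Real.rpow_nonneg hN _), ← Real.rpow_mul hN,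
        mul_one_div_cancel hr0.ne', Real.rpow_one]
    · have hpr : 1 < p.toReal := by
        rw [← ENNReal.toReal_one]
        exact (ENNReal.toReal_lt_toReal ENNReal.one_ne_top hpt).2 hp1
      refine ⟨p.toReal, hpr, ENNReal.toReal_mono hpt hqp, fun n hn x => ?_⟩
      have h0 : 0 < p.toReal := by linarith
      rw [finLpNorm_one_eq h0, finLpNorm_eq_sum h0, mul_comm]
  obtain ⟨C, hC, h⟩ := exists_sum_hilbertMatrix_rpow_le hr1
  have hr0 : 0 < r := by linarith
  -- Adding one makes the constant strictly positive, since `C` is only known to be nonnegative.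
  refine ⟨C ^ (1 / r) + 1, by positivity, fun n hn x => ?_⟩
  set y := hilbertMatrix n *ᵥ x with hy
  have hn0 : (0 : ℝ) < n := by exact_mod_cast hn
  have hX : 0 ≤ ∑ k, |x k| ^ r := Finset.sum_nonneg fun k _ => Real.rpow_nonneg (abs_nonneg _) _
  have h1 := sum_rpow_mean_le hq0 hqr hn y
  have h2 : (∑ k, |y k| ^ r) ^ (1 / r) ≤ C ^ (1 / r) * (∑ k, |x k| ^ r) ^ (1 / r) := by
    rw [← Real.mul_rpow hC hX]
    exact Real.rpow_le_rpow
      (Finset.sum_nonneg fun k _ => Real.rpow_nonneg (abs_nonneg _) _) (h n x) (by positivity)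
  have h3 := hrp n hn x
  rw [← finLpNorm_eq_sum hq0, ← finLpNorm_one_eq hq0 n] at h1
  have hq1' : 0 ≤ finLpNorm q (1 : Fin n → ℝ) := finLpNorm_nonneg q _
  have hp1' : 0 ≤ finLpNorm p (1 : Fin n → ℝ) := finLpNorm_nonneg p _
  have hxp : 0 ≤ finLpNorm p x := finLpNorm_nonneg p _
  have hnr : 0 < (n : ℝ) ^ (1 / r) := Real.rpow_pos_of_pos hn0 _
  have hCr : 0 ≤ C ^ (1 / r) := Real.rpow_nonneg hC _
  refine le_of_mul_le_mul_right ?_ hnr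
  calc finLpNorm q y * finLpNorm p (1 : Fin n → ℝ) * (n : ℝ) ^ (1 / r)
      = finLpNorm q y * (n : ℝ) ^ (1 / r) * finLpNorm p (1 : Fin n → ℝ) := by ring
    _ ≤ finLpNorm q (1 : Fin n → ℝ) * (C ^ (1 / r) * (∑ k, |x k| ^ r) ^ (1 / r)) *
          finLpNorm p (1 : Fin n → ℝ) := by
        refine mul_le_mul_of_nonneg_right ?_ hp1'
        exact h1.trans (mul_le_mul_of_nonneg_left h2 hq1')
    _ = finLpNorm q (1 : Fin n → ℝ) * C ^ (1 / r) *
          ((∑ k, |x k| ^ r) ^ (1 / r) * finLpNorm p (1 : Fin n → ℝ)) := by ring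
    _ ≤ finLpNorm q (1 : Fin n → ℝ) * C ^ (1 / r) *
          ((n : ℝ) ^ (1 / r) * finLpNorm p x) := by gcongr
    _ ≤ finLpNorm q (1 : Fin n → ℝ) * (C ^ (1 / r) + 1) *
          ((n : ℝ) ^ (1 / r) * finLpNorm p x) := by
        gcongr
        linarith
    _ = _ := by ring

/-! ### Finitely supported vectors and cyclic averaging -/

/-- Extension by zero of a finite family to a sequence. -/
def extendByZero {n : ℕ} : (Fin n → ℝ) →ₗ[ℝ] ℕ → ℝ :=
  Function.ExtendByZero.linearMap ℝ (Fin.val : Fin n → ℕ)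

@[simp]
theorem extendByZero_apply_val {n : ℕ} (x : Fin n → ℝ) (i : Fin n) :
    extendByZero x (i : ℕ) = x i :=
  Fin.val_injective.extend_apply x (0 : ℕ → ℝ) i

theorem extendByZero_apply_of_le {n : ℕ} (x : Fin n → ℝ) {i : ℕ} (hi : n ≤ i) :
    extendByZero x i = 0 :=
  Function.extend_apply' x (0 : ℕ → ℝ) i fun ⟨k, hk⟩ => by omega

theorem extendByZero_ext {n : ℕ} {x : Fin n → ℝ} {y : ℕ → ℝ} (h : ∀ i : Fin n, y i = x i)
    (h0 : ∀ i, n ≤ i → y i = 0) : y = extendByZero x := by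
  funext i
  rcases lt_or_ge i n with hi | hi
  · exact (h ⟨i, hi⟩).trans (extendByZero_apply_val x ⟨i, hi⟩).symm
  · rw [h0 i hi, extendByZero_apply_of_le x hi]

namespace SymmetricSequenceSpace

variable (E : SymmetricSequenceSpace)

theorem comp_perm_mem {x : ℕ → ℝ} (hx : x ∈ E.carrier) (σ : Equiv.Perm ℕ) :
    x ∘ σ ∈ E.carrier := by
  have h0 : Tendsto x atTop (𝓝 0) := E.tendsto_zero ⟨x, hx⟩
  have hσ : Tendsto σ atTop atTop := by
    rw [← Nat.cofinite_eq_atTop]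
    exact σ.injective.tendsto_cofinite
  rw [← E.rearrangement_mem_iff _ (h0.comp hσ), rearrangement_comp_perm,
    E.rearrangement_mem_iff _ h0]
  exact hx

theorem nrm_comp_perm {x : ℕ → ℝ} (hx : x ∈ E.carrier) (σ : Equiv.Perm ℕ) :
    E.nrm ⟨x ∘ σ, E.comp_perm_mem hx σ⟩ = E.nrm ⟨x, hx⟩ := by
  have h1 := (E.rearrangement_mem_iff x (E.tendsto_zero ⟨x, hx⟩)).2 hx
  have h2 : rearrangement (x ∘ σ) ∈ E.carrier := by rwa [rearrangement_comp_perm]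
  rw [← E.nrm_rearrangement x hx h1, ← E.nrm_rearrangement _ (E.comp_perm_mem hx σ) h2]
  congr 1
  exact Subtype.ext (rearrangement_comp_perm x σ)

theorem single_eq_comp_swap (i : ℕ) :
    (Pi.single i 1 : ℕ → ℝ) = (Pi.single 0 1 : ℕ → ℝ) ∘ Equiv.swap 0 i := by
  funext j
  simp only [Function.comp, Pi.single_apply, Equiv.swap_apply_eq_iff, Equiv.swap_apply_left]

theorem single_mem (i : ℕ) : (Pi.single i 1 : ℕ → ℝ) ∈ E.carrier := by
  rw [single_eq_comp_swap]
  exact E.comp_perm_mem E.unit_mem _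

theorem nrm_single (i : ℕ) : E.nrm ⟨Pi.single i 1, E.single_mem i⟩ = 1 := by
  refine Eq.trans ?_ ((E.nrm_comp_perm E.unit_mem (Equiv.swap 0 i)).trans E.nrm_unit)
  congr 1
  exact Subtype.ext (single_eq_comp_swap i)

/-- By solidity `x` dominates its single-coordinate truncation, and every unit vector has norm one
by symmetry. -/
theorem abs_apply_le_nrm (x : E.carrier) (i : ℕ) : |(x : ℕ → ℝ) i| ≤ E.nrm x := by
  have h := E.nrm_mono ((x : ℕ → ℝ) i • ⟨Pi.single i 1, E.single_mem i⟩) x fun j => by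
    rcases eq_or_ne j i with rfl | hj
    · simp
    · simp [hj]
  rwa [map_smul_eq_mul, nrm_single, mul_one, Real.norm_eq_abs] at h

theorem extendByZero_eq_sum {n : ℕ} (x : Fin n → ℝ) :
    extendByZero x = ∑ i, x i • (Pi.single (i : ℕ) 1 : ℕ → ℝ) := by
  refine (extendByZero_ext (fun k => ?_) fun k hk => ?_).symm
  · simp [Finset.sum_apply, Pi.single_apply, Fin.val_inj]
  · rw [Finset.sum_apply]
    refine Finset.sum_eq_zero fun i _ => ?_
    have : k ≠ i := by omega
    simp [this]

theorem extendByZero_mem {n : ℕ} (x : Fin n → ℝ) : extendByZero x ∈ E.carrier := by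
  rw [extendByZero_eq_sum]
  exact E.carrier.sum_mem fun i _ => E.carrier.smul_mem _ (E.single_mem i)

/-- The finitely supported elements of a symmetric sequence space. -/
def ofFin {n : ℕ} : (Fin n → ℝ) →ₗ[ℝ] E.carrier :=
  extendByZero.codRestrict E.carrier E.extendByZero_mem

@[simp]
theorem coe_ofFin {n : ℕ} (x : Fin n → ℝ) : (E.ofFin x : ℕ → ℝ) = extendByZero x := rfl

theorem nrm_ofFin_le_of_abs_le {n : ℕ} (x : Fin n → ℝ) (y : E.carrier)
    (h : ∀ i : Fin n, |x i| ≤ |(y : ℕ → ℝ) i|) : E.nrm (E.ofFin x) ≤ E.nrm y := by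
  refine E.nrm_mono _ _ fun i => ?_
  rw [coe_ofFin]
  rcases lt_or_ge i n with hi | hi
  · exact (le_of_eq (congrArg abs (extendByZero_apply_val x ⟨i, hi⟩))).trans (h ⟨i, hi⟩)
  · simp [extendByZero_apply_of_le x hi]

theorem nrm_ofFin_mono {n : ℕ} {x y : Fin n → ℝ} (h : ∀ i, |x i| ≤ |y i|) :
    E.nrm (E.ofFin x) ≤ E.nrm (E.ofFin y) :=
  E.nrm_ofFin_le_of_abs_le x _ fun i => by simpa using h i

theorem nrm_ofFin_le_sum {n : ℕ} (x : Fin n → ℝ) : E.nrm (E.ofFin x) ≤ ∑ i, |x i| := by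
  have h : E.ofFin x = ∑ i : Fin n, x i • (⟨Pi.single (i : ℕ) 1, E.single_mem i⟩ : E.carrier) := by
    refine Subtype.ext ?_
    rw [coe_ofFin, extendByZero_eq_sum]
    simp
  rw [h]
  refine (Finset.le_sum_of_subadditive E.nrm (map_zero E.nrm).le (map_add_le_add _) _ _).trans (le_of_eq ?_)
  exact Finset.sum_congr rfl fun i _ => by
    rw [map_smul_eq_mul, nrm_single, mul_one, Real.norm_eq_abs]

theorem one_le_nrm_ofFin_one {n : ℕ} (hn : 1 ≤ n) : 1 ≤ E.nrm (E.ofFin (1 : Fin n → ℝ)) := by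
  have h := E.abs_apply_le_nrm (E.ofFin (1 : Fin n → ℝ)) ((⟨0, hn⟩ : Fin n) : ℕ)
  rw [coe_ofFin, extendByZero_apply_val] at h
  simpa using h

theorem nrm_ofFin_comp_perm {n : ℕ} (x : Fin n → ℝ) (σ : Equiv.Perm (Fin n)) :
    E.nrm (E.ofFin (x ∘ σ)) = E.nrm (E.ofFin x) := by
  set τ : Equiv.Perm ℕ := σ.extendDomain Fin.equivSubtype with hτ
  have h : extendByZero x ∘ τ = extendByZero (x ∘ σ) := by
    refine extendByZero_ext (fun i => ?_) fun i hi => ?_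
    · have := σ.extendDomain_apply_image Fin.equivSubtype i
      simp only [Fin.equivSubtype_apply] at this
      simp [hτ, this]
    · have := σ.extendDomain_apply_not_subtype Fin.equivSubtype (not_lt.2 hi)
      simp [hτ, this, extendByZero_apply_of_le x hi]
  refine Eq.trans ?_ (E.nrm_comp_perm (E.extendByZero_mem x) τ)
  congr 1
  exact Subtype.ext h.symm

/-- The `ℓ ^ p` sum of the cyclic shifts of `x`. -/
theorem lpSum_ofFin_comp_addRight (p : ℝ≥0∞) [Fact (1 ≤ p)] {n : ℕ} [NeZero n]
    (x : Fin n → ℝ) :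
    E.lpSum p (fun k : Fin n => E.ofFin (x ∘ Equiv.addRight k)) =
      finLpNorm p x • E.ofFin (1 : Fin n → ℝ) := by
  rw [← map_smul]
  refine Subtype.ext (extendByZero_ext (fun i => ?_) fun i hi => ?_)
  -- At a fixed coordinate `i` the shifts take the values `x (i + k)`, a permutation of `x`, so
  -- their `ℓ ^ p` norm does not depend on `i`.
  · have : (fun k : Fin n => (E.ofFin (x ∘ Equiv.addRight k) : ℕ → ℝ) i) =
        x ∘ Equiv.addLeft i := by
      funext k
      simp
    change finLpNorm p (fun k : Fin n => (E.ofFin (x ∘ Equiv.addRight k) : ℕ → ℝ) i) = _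
    rw [this, finLpNorm_comp_perm]
    simp
  · have : (fun k : Fin n => (E.ofFin (x ∘ Equiv.addRight k) : ℕ → ℝ) i) = 0 := by
      funext k
      simp [extendByZero_apply_of_le _ hi]
    change finLpNorm p (fun k : Fin n => (E.ofFin (x ∘ Equiv.addRight k) : ℕ → ℝ) i) = _
    rw [this]
    simp [finLpNorm]

variable {E}

/-- Convexity for the `n` cyclic shifts of `x`: they all have the norm of `x`, while their `ℓ ^ p`
sum is a multiple of the all-ones vector. -/
theorem IsConvexWith.finLpNorm_mul_le {p : ℝ≥0∞} [Fact (1 ≤ p)] {K : ℝ}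
    (h : E.IsConvexWith p K) {n : ℕ} (hn : 1 ≤ n) (x : Fin n → ℝ) :
    finLpNorm p x * E.nrm (E.ofFin (1 : Fin n → ℝ)) ≤
      K * (E.nrm (E.ofFin x) * finLpNorm p (1 : Fin n → ℝ)) := by
  have : NeZero n := ⟨by omega⟩
  have h1 := h n fun k => E.ofFin (x ∘ Equiv.addRight k)
  simp only [nrm_ofFin_comp_perm] at h1
  rwa [lpSum_ofFin_comp_addRight, map_smul_eq_mul, Real.norm_of_nonneg (finLpNorm_nonneg p x),
    finLpNorm_const p (apply_nonneg E.nrm _)] at h1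

/-- The same averaging over shifts, with concavity reversing the inequality. -/
theorem IsConcaveWith.nrm_mul_le {q : ℝ≥0∞} [Fact (1 ≤ q)] {L : ℝ}
    (h : E.IsConcaveWith q L) {n : ℕ} (hn : 1 ≤ n) (x : Fin n → ℝ) :
    E.nrm (E.ofFin x) * finLpNorm q (1 : Fin n → ℝ) ≤
      L * (finLpNorm q x * E.nrm (E.ofFin (1 : Fin n → ℝ))) := by
  have : NeZero n := ⟨by omega⟩
  have h1 := h n fun k => E.ofFin (x ∘ Equiv.addRight k)
  simp only [nrm_ofFin_comp_perm] at h1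
  rwa [lpSum_ofFin_comp_addRight, map_smul_eq_mul, Real.norm_of_nonneg (finLpNorm_nonneg q x),
    finLpNorm_const q (apply_nonneg E.nrm _)] at h1

/-- A single unit vector already forces this; it makes the later division by `K` legitimate. -/
theorem IsConvexWith.one_le {p : ℝ≥0∞} [Fact (1 ≤ p)] {K : ℝ} (h : E.IsConvexWith p K) :
    1 ≤ K := by
  have h1 := h.finLpNorm_mul_le le_rfl (1 : Fin 1 → ℝ)
  have h2 := one_le_finLpNorm_one p (n := 1) le_rfl
  have h3 := E.one_le_nrm_ofFin_one (n := 1) le_rfl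
  refine le_of_mul_le_mul_right ?_ (mul_pos (zero_lt_one.trans_le h3) (zero_lt_one.trans_le h2))
  linarith

theorem IsConcaveWith.one_le {q : ℝ≥0∞} [Fact (1 ≤ q)] {L : ℝ} (h : E.IsConcaveWith q L) :
    1 ≤ L := by
  have h1 := h.nrm_mul_le le_rfl (1 : Fin 1 → ℝ)
  have h2 := one_le_finLpNorm_one q (n := 1) le_rfl
  have h3 := E.one_le_nrm_ofFin_one (n := 1) le_rfl
  refine le_of_mul_le_mul_right ?_ (mul_pos (zero_lt_one.trans_le h3) (zero_lt_one.trans_le h2))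
  linarith

variable (E)

/-- The upper half of `[0, n)` carries at least half of the norm of the indicator. -/
theorem nrm_ofFin_one_le_two_mul_nrm_upper_half (n : ℕ) :
    E.nrm (E.ofFin (1 : Fin n → ℝ)) ≤
      2 * E.nrm (E.ofFin (fun i : Fin n => if n ≤ 2 * ((i : ℕ) + 1) then (1 : ℝ) else 0)) := by
  set u : Fin n → ℝ := fun i => if n ≤ 2 * ((i : ℕ) + 1) then (1 : ℝ) else 0 with hu
  -- The upper half and its reversal together cover `[0, n)`, and reversal preserves the norm.
  have h1 : E.nrm (E.ofFin (1 : Fin n → ℝ)) ≤ E.nrm (E.ofFin (u + u ∘ Fin.revPerm)) := by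
    refine E.nrm_ofFin_mono fun i => ?_
    have hpos : ∀ k, 0 ≤ u k := fun k => by rw [hu]; dsimp only; split_ifs <;> norm_num
    rw [Pi.one_apply, abs_one, Pi.add_apply, Function.comp_apply,
      abs_of_nonneg (add_nonneg (hpos _) (hpos _))]
    by_cases hi : n ≤ 2 * ((i : ℕ) + 1)
    · have : u i = 1 := by simp [hu, hi]
      linarith [hpos (Fin.revPerm i)]
    · have : u (Fin.revPerm i) = 1 := by
        have h2 : n ≤ 2 * (((Fin.revPerm i : Fin n) : ℕ) + 1) := by
          rw [Fin.revPerm_apply, Fin.val_rev]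
          omega
        simp only [hu, h2, if_true]
      linarith [hpos i]
  rw [map_add] at h1
  have h2 := map_add_le_add E.nrm (E.ofFin u) (E.ofFin (u ∘ Fin.revPerm))
  rw [nrm_ofFin_comp_perm] at h2
  linarith

end SymmetricSequenceSpace

/-! ### Corner matrices, operator norms and multiplier norms -/

/-- The infinite matrix with upper left corner `M` and all other entries zero. -/
def cornerMatrix {n : ℕ} (M : Matrix (Fin n) (Fin n) ℝ) : Matrix ℕ ℕ ℝ :=
  Matrix.of fun i j => if h : i < n ∧ j < n then M ⟨i, h.1⟩ ⟨j, h.2⟩ else 0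

theorem cornerMatrix_val_val {n : ℕ} (M : Matrix (Fin n) (Fin n) ℝ) (i j : Fin n) :
    cornerMatrix M i j = M i j := by
  simp [cornerMatrix]

theorem cornerMatrix_of_le_left {n : ℕ} (M : Matrix (Fin n) (Fin n) ℝ) {i : ℕ} (hi : n ≤ i)
    (j : ℕ) : cornerMatrix M i j = 0 := by
  simp [cornerMatrix, not_lt.2 hi]

theorem cornerMatrix_of_le_right {n : ℕ} (M : Matrix (Fin n) (Fin n) ℝ) (i : ℕ) {j : ℕ}
    (hj : n ≤ j) : cornerMatrix M i j = 0 := by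
  simp [cornerMatrix, not_lt.2 hj]

theorem matrixApply_cornerMatrix {n : ℕ} (M : Matrix (Fin n) (Fin n) ℝ) (x : ℕ → ℝ) :
    matrixApply (cornerMatrix M) x = extendByZero (M *ᵥ fun k : Fin n => x k) := by
  refine extendByZero_ext (fun i => ?_) fun i hi => ?_
  · rw [matrixApply, tsum_eq_sum (s := Finset.range n), ← Fin.sum_univ_eq_sum_range
      (fun j => cornerMatrix M i j * x j)]
    · simp [cornerMatrix_val_val, Matrix.mulVec, dotProduct]
    · intro j hj
      rw [cornerMatrix_of_le_right M _ (by simpa using hj), zero_mul]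
  · simp [matrixApply, cornerMatrix_of_le_left M hi]

/-- Truncation leaves a finite corner, which is bounded between any two symmetric spaces; hence the
multiplier property is automatic. -/
theorem triangleProjection_hadamard (n : ℕ) (A : Matrix ℕ ℕ ℝ) :
    triangleProjection n ⊙ A =
      cornerMatrix (Matrix.of fun i j : Fin n => if j ≤ i then A i j else 0) := by
  ext i j
  simp only [Matrix.hadamard_apply, triangleProjection, cornerMatrix, Matrix.of_apply,
    Fin.mk_le_mk]
  split_ifs <;> first | (exfalso; omega) | simp

section

variable {E F : SymmetricSequenceSpace}

theorem abs_mulVec_le {n : ℕ} (M : Matrix (Fin n) (Fin n) ℝ) (x : E.carrier) (i : Fin n) :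
    |(M *ᵥ fun k : Fin n => (x : ℕ → ℝ) k) i| ≤ (∑ j, |M i j|) * E.nrm x := by
  rw [Finset.sum_mul, Matrix.mulVec, dotProduct]
  refine (Finset.abs_sum_le_sum_abs _ _).trans (Finset.sum_le_sum fun j _ => ?_)
  rw [abs_mul]
  exact mul_le_mul_of_nonneg_left (E.abs_apply_le_nrm x j) (abs_nonneg _)

theorem nrm_ofFin_mulVec_le {n : ℕ} (M : Matrix (Fin n) (Fin n) ℝ) (x : E.carrier) :
    F.nrm (F.ofFin (M *ᵥ fun k : Fin n => (x : ℕ → ℝ) k)) ≤ (∑ i, ∑ j, |M i j|) * E.nrm x := by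
  refine (F.nrm_ofFin_le_sum _).trans ?_
  rw [Finset.sum_mul]
  exact Finset.sum_le_sum fun i _ => abs_mulVec_le M x i

theorem mk_matrixApply_cornerMatrix {n : ℕ} (M : Matrix (Fin n) (Fin n) ℝ) (x : ℕ → ℝ)
    (h : matrixApply (cornerMatrix M) x ∈ F.carrier) :
    (⟨matrixApply (cornerMatrix M) x, h⟩ : F.carrier) = F.ofFin (M *ᵥ fun k : Fin n => x k) :=
  Subtype.ext (matrixApply_cornerMatrix M x)

variable (E F) in
theorem isBoundedMatrix_cornerMatrix {n : ℕ} (M : Matrix (Fin n) (Fin n) ℝ) :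
    IsBoundedMatrix E F (cornerMatrix M) where
  summable x i := summable_of_ne_finset_zero (s := Finset.range n) fun j hj => by
    rw [cornerMatrix_of_le_right M _ (by simpa using hj), zero_mul]
  mem x := by
    rw [matrixApply_cornerMatrix]
    exact F.extendByZero_mem _
  bound := ⟨∑ i, ∑ j, |M i j|, fun x => by
    rw [mk_matrixApply_cornerMatrix]
    exact nrm_ofFin_mulVec_le M x⟩

theorem matrixOpNorm_le {A : Matrix ℕ ℕ ℝ} (hA : IsBoundedMatrix E F A) {c : ℝ} (hc : 0 ≤ c)
    (h : ∀ x : E.carrier, F.nrm ⟨matrixApply A x, hA.mem x⟩ ≤ c * E.nrm x) :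
    matrixOpNorm hA ≤ c := by
  have : Nonempty {x : E.carrier // E.nrm x ≤ 1} := ⟨⟨0, by simp⟩⟩
  exact ciSup_le fun x => (h x.1).trans (mul_le_of_le_one_right hc x.2)

theorem nrm_matrixApply_le_matrixOpNorm {A : Matrix ℕ ℕ ℝ} (hA : IsBoundedMatrix E F A)
    {x : E.carrier} (hx : E.nrm x ≤ 1) :
    F.nrm ⟨matrixApply A x, hA.mem x⟩ ≤ matrixOpNorm hA := by
  refine le_ciSup (f := fun x : {x : E.carrier // E.nrm x ≤ 1} =>
    F.nrm ⟨matrixApply A x.1, hA.mem x.1⟩) ?_ ⟨x, hx⟩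
  obtain ⟨c, hc⟩ := hA.bound
  refine ⟨|c|, ?_⟩
  rintro _ ⟨y, rfl⟩
  refine (hc y.1).trans ?_
  exact (mul_le_mul_of_nonneg_right (le_abs_self c) (apply_nonneg _ _)).trans
    (mul_le_of_le_one_right (abs_nonneg c) y.2)

/-- Test on a unit vector and read off one coordinate. This entrywise control is what makes the
supremum in the multiplier norm finite. -/
theorem abs_apply_le_matrixOpNorm {A : Matrix ℕ ℕ ℝ} (hA : IsBoundedMatrix E F A) (i j : ℕ) :
    |A i j| ≤ matrixOpNorm hA := by
  have h := nrm_matrixApply_le_matrixOpNorm hA (E.nrm_single j).le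
  refine le_trans (le_of_eq ?_) ((F.abs_apply_le_nrm _ i).trans h)
  congr 1
  change A i j = ∑' k, A i k * (Pi.single j 1 : ℕ → ℝ) k
  rw [tsum_eq_single j fun k hk => by simp [hk]]
  simp

variable (E F) in
theorem isMultiplier_triangleProjection (n : ℕ) : IsMultiplier E F (triangleProjection n) :=
  fun A _ => by
    rw [triangleProjection_hadamard]
    exact isBoundedMatrix_cornerMatrix E F _

theorem matrixOpNorm_cornerMatrix_le {n : ℕ} (M : Matrix (Fin n) (Fin n) ℝ) {A : Matrix ℕ ℕ ℝ}
    (hA : IsBoundedMatrix E F A) (h : A = cornerMatrix M) :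
    matrixOpNorm hA ≤ ∑ i, ∑ j, |M i j| := by
  subst h
  refine matrixOpNorm_le hA
    (Finset.sum_nonneg fun i _ => Finset.sum_nonneg fun j _ => abs_nonneg _) fun x => ?_
  rw [mk_matrixApply_cornerMatrix]
  exact nrm_ofFin_mulVec_le M x

/-- A real supremum dominates its members only when bounded above; the crude bound `n ^ 2`, one for
each entry of the corner, is enough. -/
theorem matrixOpNorm_le_multiplierNorm_triangleProjection {n : ℕ}
    (hM : IsMultiplier E F (triangleProjection n)) {A : Matrix ℕ ℕ ℝ}
    (hA : IsBoundedMatrix E F A) (h : matrixOpNorm hA ≤ 1) :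
    matrixOpNorm (hM A hA) ≤ multiplierNorm hM := by
  refine le_ciSup (f := fun A : {A : Matrix ℕ ℕ ℝ //
    ∃ hA : IsBoundedMatrix E F A, matrixOpNorm hA ≤ 1} =>
      matrixOpNorm (hM A.1 A.2.choose)) ?_ ⟨A, hA, h⟩
  refine ⟨∑ _i : Fin n, ∑ _j : Fin n, 1, ?_⟩
  rintro _ ⟨⟨B, hB, hB1⟩, rfl⟩
  refine (matrixOpNorm_cornerMatrix_le _ _ (triangleProjection_hadamard n B)).trans ?_
  refine Finset.sum_le_sum fun i _ => Finset.sum_le_sum fun j _ => ?_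
  rw [Matrix.of_apply]
  split_ifs
  · exact (abs_apply_le_matrixOpNorm hB i j).trans hB1
  · simp

end

/-! ### Logarithmic growth and the final estimate -/

/-- The truncated row sum is at least a quarter of the harmonic number of `i + 1`, hence at least
`log (i + 2) / 4`. In the upper half `n ≤ 2 * (i + 1) ≤ (i + 2) ^ 2`, which costs another factor
`2`. -/
theorem log_le_sum_lower_hilbertMatrix {n : ℕ} (i : Fin n) (hi : n ≤ 2 * ((i : ℕ) + 1)) :
    Real.log n / 8 ≤ ∑ j : Fin n, if j ≤ i then hilbertMatrix n i j else 0 := by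
  have hn : (0 : ℝ) < n := by exact_mod_cast i.pos
  have h1 : Real.log n ≤ 2 * Real.log (((i : ℕ) + 1 + 1 : ℕ) : ℝ) := by
    rw [← Real.log_rpow (by positivity), Real.rpow_two]
    refine Real.log_le_log hn ?_
    have : (n : ℝ) ≤ 2 * ((i : ℕ) + 1) := by exact_mod_cast hi
    push_cast
    nlinarith
  have h2 := log_add_one_le_harmonic ((i : ℕ) + 1)
  have h3 : (harmonic ((i : ℕ) + 1) : ℝ) =
      ∑ j ∈ Finset.range ((i : ℕ) + 1), 1 / (((i : ℕ) : ℝ) - j + 1) := by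
    rw [harmonic, ← Finset.sum_range_reflect]
    push_cast
    refine Finset.sum_congr rfl fun j hj => ?_
    have hj' : j ≤ (i : ℕ) := Nat.lt_succ_iff.1 (Finset.mem_range.1 hj)
    rw [Nat.cast_sub hj', one_div]
  have h4 : ∑ j ∈ Finset.range ((i : ℕ) + 1), 1 / (((i : ℕ) : ℝ) - j + 1) =
      ∑ j : Fin n, if j ≤ i then 1 / (((i : ℕ) : ℝ) - (j : ℕ) + 1) else 0 := by
    have := Fin.sum_univ_eq_sum_range
      (fun j : ℕ => if j ≤ (i : ℕ) then 1 / (((i : ℕ) : ℝ) - (j : ℕ) + 1) else 0) n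
    simp only [Fin.le_def]
    rw [this, ← Finset.sum_filter]
    refine Finset.sum_congr ?_ fun _ _ => rfl
    ext j
    simp only [Finset.mem_range, Finset.mem_filter]
    omega
  have h5 : (∑ j : Fin n, if j ≤ i then 1 / (((i : ℕ) : ℝ) - (j : ℕ) + 1) else 0) / 4 ≤
      ∑ j : Fin n, if j ≤ i then hilbertMatrix n i j else 0 := by
    rw [Finset.sum_div]
    refine Finset.sum_le_sum fun j _ => ?_
    split_ifs with hj
    · refine le_trans (le_of_eq ?_) (one_div_le_hilbertMatrix hj)
      rw [div_div, mul_comm]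
    · simp
  rw [← h4, ← h3] at h5
  linarith

/-- The norm of `hilbertMatrix n` from a `p`-convex to a `q`-concave symmetric space. -/
theorem nrm_hilbertMatrix_mulVec_le {p q : ℝ≥0∞} [Fact (1 ≤ p)] [Fact (1 ≤ q)]
    {E F : SymmetricSequenceSpace} {K L : ℝ} (hE : E.IsConvexWith p K)
    (hF : F.IsConcaveWith q L) {n : ℕ} (hn : 1 ≤ n) {C : ℝ} (hC : 0 ≤ C)
    (h : ∀ x : Fin n → ℝ,
      finLpNorm q (hilbertMatrix n *ᵥ x) * finLpNorm p (1 : Fin n → ℝ) ≤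
        C * (finLpNorm q (1 : Fin n → ℝ) * finLpNorm p x)) (x : Fin n → ℝ) :
    F.nrm (F.ofFin (hilbertMatrix n *ᵥ x)) * E.nrm (E.ofFin (1 : Fin n → ℝ)) ≤
      C * K * L * F.nrm (F.ofFin (1 : Fin n → ℝ)) * E.nrm (E.ofFin x) := by
  have h1 := hE.finLpNorm_mul_le hn x
  have h2 := hF.nrm_mul_le hn (hilbertMatrix n *ᵥ x)
  have h3 := h x
  have hK := hE.one_le
  have hL := hF.one_le
  have hp1 := one_le_finLpNorm_one p hn
  have hq1 := one_le_finLpNorm_one q hn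
  have hE1 := E.one_le_nrm_ofFin_one hn
  have hF1 := F.one_le_nrm_ofFin_one hn
  set a := finLpNorm p (1 : Fin n → ℝ)
  set b := finLpNorm q (1 : Fin n → ℝ)
  set e := E.nrm (E.ofFin (1 : Fin n → ℝ))
  set f := F.nrm (F.ofFin (1 : Fin n → ℝ))
  set y := hilbertMatrix n *ᵥ x
  have hab : 0 < b * a := by positivity
  refine le_of_mul_le_mul_right ?_ hab
  -- The three inequalities used are, in order, concavity of `F`, the normalized `ℓ ^ p` to `ℓ ^ q`
  -- bound, and convexity of `E`.
  calc F.nrm (F.ofFin y) * e * (b * a) = F.nrm (F.ofFin y) * b * (e * a) := by ring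
    _ ≤ L * (finLpNorm q y * f) * (e * a) := by gcongr
    _ = L * f * e * (finLpNorm q y * a) := by ring
    _ ≤ L * f * e * (C * (b * finLpNorm p x)) := by gcongr
    _ = L * f * C * b * (finLpNorm p x * e) := by ring
    _ ≤ L * f * C * b * (K * (E.nrm (E.ofFin x) * a)) := by gcongr
    _ = _ := by ring

end

theorem proposition5 (p q : ℝ≥0∞) [Fact (1 ≤ p)] [Fact (1 ≤ q)]
    (hp : p ≠ 1) (hq : q ≠ ∞) (hqp : q ≤ p) :
    ∃ C : ℝ, 0 < C ∧
      ∀ (E F : SymmetricSequenceSpace) (K L : ℝ),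
        E.IsConvexWith p K → F.IsConcaveWith q L →
          ∀ n : ℕ, 1 ≤ n →
            ∃ hT : IsMultiplier E F (triangleProjection n),
              C / (K * L) * Real.log n ≤ multiplierNorm hT := by
  obtain ⟨C, hC, hCn⟩ := exists_finLpNorm_hilbertMatrix_le p q hp hq hqp
  -- The `16` combines the `8` of the row-sum bound with the `2` lost on restricting to the upper
  -- half.
  refine ⟨1 / (16 * C), by positivity, fun E F K L hE hF n hn =>
    ⟨isMultiplier_triangleProjection E F n, ?_⟩⟩
  set hT := isMultiplier_triangleProjection E F n
  have hH := nrm_hilbertMatrix_mulVec_le hE hF hn hC.le (hCn n hn)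
  have hK := hE.one_le
  have hL := hF.one_le
  have hE1 := E.one_le_nrm_ofFin_one hn
  have hF1 := F.one_le_nrm_ofFin_one hn
  have hhalf := F.nrm_ofFin_one_le_two_mul_nrm_upper_half n
  set e := E.nrm (E.ofFin (1 : Fin n → ℝ))
  set f := F.nrm (F.ofFin (1 : Fin n → ℝ))
  set u : Fin n → ℝ := fun i => if n ≤ 2 * ((i : ℕ) + 1) then (1 : ℝ) else 0 with hu
  -- The bound for the norm of the smoothed Hilbert matrix from `E` to `F`; dividing by it puts the
  -- test matrix in the unit ball.
  set c := C * K * L * f / e with hc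
  have he0 : 0 < e := by positivity
  have hc0 : 0 < c := by positivity
  have hlog : 0 ≤ Real.log n := Real.log_nonneg (by exact_mod_cast hn)
  set A := cornerMatrix (c⁻¹ • hilbertMatrix n) with hA
  have hAb : IsBoundedMatrix E F A := isBoundedMatrix_cornerMatrix E F _
  have hA1 : matrixOpNorm hAb ≤ 1 := by
    refine matrixOpNorm_le hAb zero_le_one fun x => ?_
    rw [mk_matrixApply_cornerMatrix, Matrix.smul_mulVec, map_smul, map_smul_eq_mul,
      Real.norm_of_nonneg (inv_nonneg.2 hc0.le), one_mul, inv_mul_le_iff₀ hc0]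
    set z : Fin n → ℝ := fun k => (x : ℕ → ℝ) k
    have h1 : E.nrm (E.ofFin z) ≤ E.nrm x := E.nrm_ofFin_le_of_abs_le z x fun i => le_rfl
    refine le_trans ?_ (mul_le_mul_of_nonneg_left h1 hc0.le)
    rw [hc, div_mul_eq_mul_div, le_div_iff₀ he0]
    exact hH z
  have hv : E.nrm (e⁻¹ • E.ofFin (1 : Fin n → ℝ)) ≤ 1 := by
    rw [map_smul_eq_mul, Real.norm_of_nonneg (inv_nonneg.2 he0.le)]
    exact (inv_mul_cancel₀ he0.ne').le
  refine le_trans ?_ (matrixOpNorm_le_multiplierNorm_triangleProjection hT hAb hA1)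
  refine le_trans ?_ (nrm_matrixApply_le_matrixOpNorm (hT A hAb) hv)
  set t := c⁻¹ * e⁻¹ * (Real.log n / 8) with ht
  have ht0 : 0 ≤ t := by positivity
  -- The image of the normalized all-ones vector is at least `t` at each coordinate of the upper
  -- half, so solidity of `F` applies.
  have hlow : t * F.nrm (F.ofFin u) ≤
      F.nrm ⟨matrixApply (triangleProjection n ⊙ A)
        (e⁻¹ • E.ofFin (1 : Fin n → ℝ) : E.carrier), (hT A hAb).mem _⟩ := by
    have h1 : F.nrm (F.ofFin (t • u)) = t * F.nrm (F.ofFin u) := by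
      rw [map_smul, map_smul_eq_mul, Real.norm_of_nonneg ht0]
    rw [← h1]
    refine F.nrm_ofFin_le_of_abs_le _ _ fun i => ?_
    have h2 : matrixApply (triangleProjection n ⊙ A)
        (e⁻¹ • E.ofFin (1 : Fin n → ℝ) : E.carrier) (i : ℕ) =
          c⁻¹ * e⁻¹ * ∑ j : Fin n, if j ≤ i then hilbertMatrix n i j else 0 := by
      rw [triangleProjection_hadamard, matrixApply_cornerMatrix, extendByZero_apply_val,
        Finset.mul_sum, Matrix.mulVec, dotProduct]
      refine Finset.sum_congr rfl fun j _ => ?_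
      simp only [Matrix.of_apply, hA, cornerMatrix_val_val, Matrix.smul_apply, smul_eq_mul,
        Submodule.coe_smul, Pi.smul_apply, SymmetricSequenceSpace.coe_ofFin,
        extendByZero_apply_val, Pi.one_apply, mul_one]
      split_ifs
      · ring
      · simp
    change |(t • u) i| ≤ |matrixApply (triangleProjection n ⊙ A)
        (e⁻¹ • E.ofFin (1 : Fin n → ℝ) : E.carrier) (i : ℕ)|
    rw [h2, Pi.smul_apply, smul_eq_mul, hu]
    dsimp only
    split_ifs with hi
    · rw [mul_one, abs_of_nonneg ht0]
      refine le_trans ?_ (le_abs_self _)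
      exact mul_le_mul_of_nonneg_left (log_le_sum_lower_hilbertMatrix i hi) (by positivity)
    · rw [mul_zero, abs_zero]
      exact abs_nonneg _
  refine le_trans ?_ hlow
  have h3 : t * (f / 2) ≤ t * F.nrm (F.ofFin u) :=
    mul_le_mul_of_nonneg_left (by linarith) ht0
  refine le_trans (le_of_eq ?_) h3
  rw [ht, hc]
  field_simp
  ring
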